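/- Let $E$ be a real affine Euclidean space with translation space $V$ of finite dimension $n\ge 1$ and scalar product $(\cdot,\cdot)$, and let $\widehat E$ be the real vector space of affine linear functions $a:E\to\mathbb R$, with gradient $Da\in V$ determined by $a(e+v)=a(e)+(Da,v)$. Put $(a,b):=(Da,Db)$ and, if $Da\neq 0$, let $a^\vee:=2a/(a,a)$ and let $s_a$ be the orthogonal reflection of $E$ in the hyperplane $a^{-1}(0)$; isometries $g$ of $E$ act on $\widehat E$ by $(ga)(e)=a(g^{-1}e)$. For a set $R$ of affine linear functions with nonzero gradient, let $W=W(R)$ be the group generated by the reflections $s_a$ $(a\in R)$. Recall that $R$ is an affine root system if $R$ spans $\widehat E$, $W$ stabilizes $R$, $(a^\vee,b)\in\mathbb Z$ for all $a,b\in R$, $W$ acts properly on $E$, and the vectors $v\in V$ whose translations lie in $W$ span $V$. It is irreducible if it is not a nontrivial orthogonal disjoint union. Let $R$ be an irreducible affine root system, possibly nonreduced, and let $\Delta=(a_0,\dots,a_n)$ be an ordered basis of $R$: an $\mathbb R$-basis of $\widehat E$ consisting of indivisible affine roots (roots $a\in R$ with $a/2\notin R$) such that $\{e\in E: a_i(e)>0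 \text{ for all } i\}$ is a chamber, i.e. a connected component of $E\setminus\bigcup_{a\in R}a^{-1}(0)$. Write $s_i=s_{a_i}$. Let $k:R\to\mathbb C\setminus\{0\}$, $a\mapsto k_a$, be $W$-equivariant, i.e. $k_{wa}=k_a$ for all $w\in W$, $a\in R$. Put $k_i:=k_{a_i}$, and $k_{2a}:=k_a$ whenever $a\in R$ and $2a\notin R$. Let $A=(a_{ij})_{0\le i,j\le n}$ with $a_{ij}=(a_i^\vee,a_j)$ be the affine Cartan matrix of $(R,\Delta)$, and for $i\ne j$ let $m_{ij}=2,3,4,6,\infty$ according to whether $a_{ij}a_{ji}=0,1,2,3,\geq 4$. The affine Hecke algebra $H(W(R),k^{ind})$, where $k^{ind}$ is the restriction of $k$ to the indivisible roots, is the quotient of the complex group algebra of the braid group with generators $T_0,\dots,T_n$ and defining relations $T_iT_jT_i\cdots=T_jT_iT_j\cdots$ ($m_{ij}$ factors on each side, $i\neq j$, no relation if $m_{ij}=\infty$) by the two-sided ideal generated by the elements $(T_i-k_i)(T_i+k_i^{-1})$, $0\le i\le n$. Let $F$ be the quotient field of the complex group algebra $\mathbb C[\mathbb ZR]$ of the lattice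 $\mathbb ZR\subset\widehat E$ spanned by $R$, with standard basis $e^\lambda$ $(\lambda\in\mathbb ZR)$ of $\mathbb C[\mathbb ZR]$. The group $W$ acts on $F$ by field automorphisms with $w(e^\lambda)=e^{w\lambda}$ and trivially on $\mathbb C$; let $W\ltimes F$ be the corresponding semidirect product algebra over $\mathbb C$ (the free left $F$-module on $W$, with $w f=w(f)\,w$). Then there is a unique injective homomorphism of unital $\mathbb C$-algebras $\beta: H(W(R),k^{ind})\hookrightarrow W\ltimes F$ such that $$\beta(T_i)=k_i s_i+\frac{k_i-k_i^{-1}+(k_{2a_i}-k_{2a_i}^{-1})e^{a_i}}{1-e^{2a_i}}\,(1-s_i)\qquad (0\le i\le n).$$ -/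

import Mathlib

set_option linter.unusedSectionVars false

noncomputable section

/-! ### Braid groups and Hecke algebras of (generalized Cartan) matrices -/

namespace CartanHecke

variable {ι : Type*}

/-- The exponent `m i j`: `m i i = 1`, and for `i ≠ j` it is `2, 3, 4, 6, ∞` when
`A i j * A j i` is `0, 1, 2, 3, ≥ 4` respectively. -/
def braidExponent [DecidableEq ι] (A : Matrix ι ι ℤ) (i j : ι) : ℕ∞ :=
  if i = j then 1
  else if A i j * A j i = 0 then 2
  else if A i j * A j i = 1 then 3
  else if A i j * A j i = 2 then 4
  else if A i j * A j i = 3 then 6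
  else ⊤

/-- The alternating word `T i * T j * T i * ⋯` with `m` factors. -/
def altWord (i j : ι) : ℕ → FreeGroup ι
  | 0 => 1
  | m + 1 => FreeGroup.of i * altWord j i m

/-- The braid relations, for all `i ≠ j` with `m i j` finite. -/
def braidRelations [DecidableEq ι] (A : Matrix ι ι ℤ) : Set (FreeGroup ι) :=
  {r | ∃ (i j : ι) (m : ℕ), i ≠ j ∧ braidExponent A i j = m ∧
    r = altWord i j m * (altWord j i m)⁻¹}

/-- The braid group of `A`. -/
abbrev BraidGroup [DecidableEq ι] (A : Matrix ι ι ℤ) : Type _ :=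
  PresentedGroup (braidRelations A)

/-- The generator `T i` in the complex group algebra of the braid group. -/
def braidT [DecidableEq ι] (A : Matrix ι ι ℤ) (i : ι) : MonoidAlgebra ℂ (BraidGroup A) :=
  MonoidAlgebra.of ℂ (BraidGroup A) (PresentedGroup.of i)

/-- The quadratic relations `(T i - k i) (T i + (k i)⁻¹) = 0`. -/
inductive HeckeRel [DecidableEq ι] (A : Matrix ι ι ℤ) (k : ι → ℂˣ) :
    MonoidAlgebra ℂ (BraidGroup A) → MonoidAlgebra ℂ (BraidGroup A) → Prop
  | quadratic (i : ι) : HeckeRel A k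
      ((braidT A i - algebraMap ℂ _ (k i : ℂ)) * (braidT A i + algebraMap ℂ _ ((k i : ℂ)⁻¹))) 0

/-- The Hecke algebra `H(A, k)`: the quotient of the complex group algebra of the braid group by
the two-sided ideal generated by the elements `(T i - k i) (T i + (k i)⁻¹)`. -/
abbrev HeckeAlgebra [DecidableEq ι] (A : Matrix ι ι ℤ) (k : ι → ℂˣ) : Type _ :=
  RingQuot (HeckeRel A k)

/-- The generator `T i` of the Hecke algebra. -/
def heckeT [DecidableEq ι] (A : Matrix ι ι ℤ) (k : ι → ℂˣ) (i : ι) : HeckeAlgebra A k :=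
  RingQuot.mkAlgHom ℂ (HeckeRel A k) (braidT A i)

end CartanHecke

/-! ### Affine linear functions and reflections on an affine Euclidean space -/

namespace AffineRoot

variable {V P : Type*} [NormedAddCommGroup V] [InnerProductSpace ℝ V] [FiniteDimensional ℝ V]
  [MetricSpace P] [NormedAddTorsor V P]

/-- The gradient `Da` of an affine linear function `a`. -/
def grad (a : P →ᵃ[ℝ] ℝ) : V :=
  (InnerProductSpace.toDual ℝ V).symm (LinearMap.toContinuousLinearMap a.linear)

theorem inner_grad (a : P →ᵃ[ℝ] ℝ) (v : V) : inner ℝ (grad a) v = a.linear v := by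
  simp [grad]

/-- `a (e + v) = a e + (Da, v)`. -/
theorem apply_vadd (a : P →ᵃ[ℝ] ℝ) (v : V) (e : P) :
    a (v +ᵥ e) = a e + inner ℝ (grad a) v := by
  rw [inner_grad, AffineMap.map_vadd, vadd_eq_add, add_comm]

/-- The covector `v^∨ = 2 v / |v|^2`. -/
def covector (v : V) : V := (2 / ‖v‖ ^ 2) • v

/-- The number `(a^∨, b)`, i.e. the scalar product of `(Da)^∨` and `Db`. -/
def pairing (a b : P →ᵃ[ℝ] ℝ) : ℝ := inner ℝ (covector (grad a)) (grad b)

/-- The orthogonal reflection `s_a` of `P` in the hyperplane `a⁻¹(0)`: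
`s_a(e) = e - a(e) (Da)^∨`. -/
def reflection (a : P →ᵃ[ℝ] ℝ) : P ≃ᵃⁱ[ℝ] P :=
  AffineIsometryEquiv.mk' (fun e => -(a e • covector (grad a)) +ᵥ e)
    ((Submodule.span ℝ {grad a})ᗮ.reflection) (Classical.arbitrary P) (by
      intro e
      obtain ⟨v, rfl⟩ : ∃ v : V, e = v +ᵥ Classical.arbitrary P :=
        ⟨e -ᵥ Classical.arbitrary P, (vsub_vadd _ _).symm⟩
      rw [apply_vadd, vadd_vsub, vadd_vadd, vadd_vadd, Submodule.reflection_orthogonal_apply,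
        Submodule.reflection_singleton_apply, covector]
      congr 1
      simp only [RCLike.ofReal_real_eq_id, id_eq]
      module)

@[simp]
theorem reflection_apply (a : P →ᵃ[ℝ] ℝ) (e : P) :
    reflection a e = -(a e • covector (grad a)) +ᵥ e := rfl

/-- The contragredient action `(g a)(e) = a (g⁻¹ e)` of isometries on affine linear functions. -/
def act (g : P ≃ᵃⁱ[ℝ] P) (a : P →ᵃ[ℝ] ℝ) : P →ᵃ[ℝ] ℝ :=
  a.comp (g⁻¹ : P ≃ᵃⁱ[ℝ] P).toAffineEquiv.toAffineMap

@[simp]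
theorem act_apply (g : P ≃ᵃⁱ[ℝ] P) (a : P →ᵃ[ℝ] ℝ) (e : P) : act g a e = a (g⁻¹ e) := rfl

theorem act_one (a : P →ᵃ[ℝ] ℝ) : act 1 a = a := by ext e; simp

theorem act_mul (g h : P ≃ᵃⁱ[ℝ] P) (a : P →ᵃ[ℝ] ℝ) : act (g * h) a = act g (act h a) := by
  ext e; simp

/-- The group `W(S)` generated by the reflections `s_a`, `a ∈ S`. -/
def reflectionGroup (S : Set (P →ᵃ[ℝ] ℝ)) : Subgroup (P ≃ᵃⁱ[ℝ] P) :=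
  Subgroup.closure (reflection '' S)

/-- The set `L_W` of vectors `v` such that the translation by `v` belongs to `W`. -/
def translations (W : Subgroup (P ≃ᵃⁱ[ℝ] P)) : Set V :=
  {v | AffineIsometryEquiv.constVAdd ℝ P v ∈ W}

end AffineRoot

/-! ### Affine root systems -/

open AffineRoot

/-- An affine root system on the affine Euclidean space `P` with translation space `V`. -/
structure AffineRootSystem (V P : Type*) [NormedAddCommGroup V] [InnerProductSpace ℝ V]
    [FiniteDimensional ℝ V] [MetricSpace P] [NormedAddTorsor V P] where
  /-- the set of affine roots -/
  roots : Set (P →ᵃ[ℝ] ℝ)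
  nonisotropic : ∀ a ∈ roots, grad a ≠ 0
  span_eq_top : Submodule.span ℝ roots = ⊤
  act_mem : ∀ w ∈ reflectionGroup roots, ∀ a ∈ roots, act w a ∈ roots
  integral : ∀ a ∈ roots, ∀ b ∈ roots, ∃ z : ℤ, pairing a b = z
  proper : ∀ K₁ K₂ : Set P, IsCompact K₁ → IsCompact K₂ →
    {w : P ≃ᵃⁱ[ℝ] P | w ∈ reflectionGroup roots ∧ (w '' K₁ ∩ K₂).Nonempty}.Finite
  span_translations : Submodule.span ℝ (translations (reflectionGroup roots)) = ⊤

namespace AffineRootSystem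

variable {V P : Type*} [NormedAddCommGroup V] [InnerProductSpace ℝ V] [FiniteDimensional ℝ V]
  [MetricSpace P] [NormedAddTorsor V P] (R : AffineRootSystem V P)

/-- `R` is irreducible if it is not a nontrivial orthogonal disjoint union. -/
def IsIrreducible : Prop :=
  ∀ R₁ R₂ : Set (P →ᵃ[ℝ] ℝ), R.roots = R₁ ∪ R₂ → Disjoint R₁ R₂ →
    (∀ a ∈ R₁, ∀ b ∈ R₂, inner ℝ (grad a) (grad b) = 0) → R₁ = ∅ ∨ R₂ = ∅

/-- The affine Weyl group `W(R)`. -/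
def weylGroup : Subgroup (P ≃ᵃⁱ[ℝ] P) := reflectionGroup R.roots

/-- The reflection `s_a` in an affine root `a`, as an element of `W(R)`. -/
def s (a : R.roots) : R.weylGroup :=
  ⟨reflection (a : P →ᵃ[ℝ] ℝ), Subgroup.subset_closure ⟨a, a.2, rfl⟩⟩

/-- The action of the affine Weyl group on the affine roots. -/
def rootAct (w : R.weylGroup) (a : R.roots) : R.roots :=
  ⟨act (w : P ≃ᵃⁱ[ℝ] P) a, R.act_mem w w.2 a a.2⟩

/-- The set of regular points: the complement of all the hyperplanes `a⁻¹(0)`, `a ∈ R`. -/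
def regular : Set P := {e | ∀ a ∈ R.roots, a e ≠ 0}

/-- Chambers are the connected components of the set of regular points. -/
def IsChamber (C : Set P) : Prop := ∃ e ∈ R.regular, C = connectedComponentIn R.regular e

/-- An ordered basis `(a_0, …, a_n)` of `R`: an ordering of the basis of indivisible affine roots
attached to a chamber. (As it is a basis of the space of affine linear functions,
`n` is the dimension of `V`.) -/
structure OrderedBasis (n : ℕ) where
  /-- the simple affine roots -/
  root : Fin (n + 1) → P →ᵃ[ℝ] ℝ
  mem : ∀ i, root i ∈ R.roots
  indivisible : ∀ i, (1 / 2 : ℝ) • root i ∉ R.roots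
  linearIndependent : LinearIndependent ℝ root
  span_eq_top : Submodule.span ℝ (Set.range root) = ⊤
  isChamber : R.IsChamber {e | ∀ i, 0 < root i e}

/-- The affine Cartan integer `(a^∨, b)` of two affine roots. -/
def cartanInt (a b : R.roots) : ℤ := (R.integral a a.2 b b.2).choose

theorem cartanInt_spec (a b : R.roots) :
    (R.cartanInt a b : ℝ) = pairing (a : P →ᵃ[ℝ] ℝ) b :=
  (R.integral a a.2 b b.2).choose_spec.symm

namespace OrderedBasis

variable {R} {n : ℕ} (Δ : R.OrderedBasis n)

/-- The simple affine root `a_i` as an element of `R`. -/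
def simpleRoot (i : Fin (n + 1)) : R.roots := ⟨Δ.root i, Δ.mem i⟩

/-- The affine Cartan matrix `A(R, Δ)`, with entries `(a_i^∨, a_j)`. -/
def cartanMatrix : Matrix (Fin (n + 1)) (Fin (n + 1)) ℤ :=
  fun i j => R.cartanInt (Δ.simpleRoot i) (Δ.simpleRoot j)

/-- The affine Hecke algebra `H(W(R), k^ind)`. It only depends on the values `k_i = k_{a_i}`. -/
abbrev AffineHecke (k : R.roots → ℂˣ) : Type _ :=
  CartanHecke.HeckeAlgebra Δ.cartanMatrix (fun i => k (Δ.simpleRoot i))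

/-- The generator `T_i` of the affine Hecke algebra. -/
def T (k : R.roots → ℂˣ) (i : Fin (n + 1)) : Δ.AffineHecke k :=
  CartanHecke.heckeT Δ.cartanMatrix (fun i => k (Δ.simpleRoot i)) i

end OrderedBasis

/-! ### The field `F` and the algebra `W ⋉ F` -/

/-- The lattice `ℤR`. -/
def rootLattice : AddSubgroup (P →ᵃ[ℝ] ℝ) := AddSubgroup.closure R.roots

theorem act_mem_rootLattice (w : R.weylGroup) (x : P →ᵃ[ℝ] ℝ) (hx : x ∈ R.rootLattice) :
    act (w : P ≃ᵃⁱ[ℝ] P) x ∈ R.rootLattice := by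
  induction hx using AddSubgroup.closure_induction with
  | mem y hy => exact AddSubgroup.subset_closure (R.act_mem w w.2 y hy)
  | zero => exact R.rootLattice.zero_mem
  | add y z _ _ hy hz => exact R.rootLattice.add_mem hy hz
  | neg y _ hy => exact R.rootLattice.neg_mem hy

/-- The action of an element of the affine Weyl group on `ℤR`. -/
def latticeAct (w : R.weylGroup) : R.rootLattice ≃+ R.rootLattice where
  toFun x := ⟨act (w : P ≃ᵃⁱ[ℝ] P) x, R.act_mem_rootLattice w x x.2⟩
  invFun x := ⟨act ((w⁻¹ : R.weylGroup) : P ≃ᵃⁱ[ℝ] P) x, R.act_mem_rootLattice w⁻¹ x x.2⟩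
  left_inv x := by
    ext1
    change act _ (act _ _) = _
    rw [← act_mul, ← Subgroup.coe_mul, inv_mul_cancel, Subgroup.coe_one, act_one]
  right_inv x := by
    ext1
    change act _ (act _ _) = _
    rw [← act_mul, ← Subgroup.coe_mul, mul_inv_cancel, Subgroup.coe_one, act_one]
  map_add' _ _ := rfl

instance : TwoUniqueSums R.rootLattice :=
  letI : Module ℚ (P →ᵃ[ℝ] ℝ) := Module.compHom _ (algebraMap ℚ ℝ)
  TwoUniqueSums.of_injective_addHom (R.rootLattice.subtype : R.rootLattice →ₙ+ (P →ᵃ[ℝ] ℝ))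
    Subtype.val_injective inferInstance

/-- The group algebra `ℂ[ℤR]`. -/
abbrev GroupAlg : Type _ := AddMonoidAlgebra ℂ R.rootLattice

/-- The field `F = Quot(ℂ[ℤR])`. -/
abbrev F : Type _ := FractionRing R.GroupAlg

/-- The action `w (e^λ) = e^{w λ}` of the affine Weyl group on `ℂ[ℤR]`. -/
def groupAlgAct : R.weylGroup →* (R.GroupAlg ≃ₐ[ℂ] R.GroupAlg) where
  toFun w := AddMonoidAlgebra.domCongr ℂ ℂ (R.latticeAct w)
  map_one' := by
    have : R.latticeAct 1 = AddEquiv.refl _ := by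
      ext1 x; ext1; exact act_one _
    rw [this, AddMonoidAlgebra.domCongr_refl]; rfl
  map_mul' w w' := by
    have : R.latticeAct (w * w') = (R.latticeAct w').trans (R.latticeAct w) := by
      ext1 x; ext1; exact act_mul _ _ _
    rw [this, ← AddMonoidAlgebra.trans_domCongr_domCongr]; rfl

/-- The action of the affine Weyl group on `F` by field automorphisms. -/
def fieldAct : R.weylGroup →* (R.F ≃ₐ[ℂ] R.F) :=
  (IsFractionRing.fieldEquivOfAlgEquivHom ℂ R.F).comp R.groupAlgAct

instance : MulSemiringAction R.weylGroup R.F := MulSemiringAction.compHom R.F R.fieldAct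

instance : SMulCommClass R.weylGroup ℂ R.F where
  smul_comm w c f := map_smul (R.fieldAct w) c f

/-- The element `e^λ` of `F`. -/
def e (x : R.rootLattice) : R.F := algebraMap R.GroupAlg R.F (AddMonoidAlgebra.single x 1)

theorem smul_e (w : R.weylGroup) (x : R.rootLattice) : w • R.e x = R.e (R.latticeAct w x) := by
  change IsFractionRing.fieldEquivOfAlgEquiv ℂ R.F R.F (R.groupAlgAct w) (algebraMap _ _ _) = _
  rw [IsFractionRing.fieldEquivOfAlgEquiv_algebraMap]
  simp [groupAlgAct, e]

/-- The semidirect product algebra `W ⋉ F`: the free left `F`-module on `W` with multiplication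
`(f w) (f' w') = f w(f') w w'`. -/
abbrev WF : Type _ := SkewMonoidAlgebra R.F R.weylGroup

/-- The embedding of `W` into `W ⋉ F`. -/
def ofW (w : R.weylGroup) : R.WF := SkewMonoidAlgebra.single w 1

/-- The embedding of `F` into `W ⋉ F`. -/
def ofF (f : R.F) : R.WF := SkewMonoidAlgebra.single 1 f

/-- An affine root as an element of `ℤR`. -/
def rootInLattice (a : R.roots) : R.rootLattice := ⟨a, AddSubgroup.subset_closure a.2⟩

open Classical in
/-- `k_{2a}`, with the convention `k_{2a} = k_a` if `2a` is not an affine root. -/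
def kTwo (k : R.roots → ℂˣ) (a : R.roots) : ℂˣ :=
  if h : (2 : ℝ) • (a : P →ᵃ[ℝ] ℝ) ∈ R.roots then k ⟨_, h⟩ else k a

/-- The rational function
`(k_a - k_a⁻¹ + (k_{2a} - k_{2a}⁻¹) e^a) / (1 - e^{2a})` in `F`. -/
def cFunction (k : R.roots → ℂˣ) (a : R.roots) : R.F :=
  (algebraMap ℂ R.F (k a - (k a : ℂ)⁻¹) +
      algebraMap ℂ R.F (R.kTwo k a - (R.kTwo k a : ℂ)⁻¹) * R.e (R.rootInLattice a)) /
    (1 - R.e (2 • R.rootInLattice a))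

end AffineRootSystem

end

/-! ### Rank two identities for the rational functions `(k - k⁻¹ x) / (1 - x)` -/

namespace RankTwo

/-! Existence. Adding k_i⁻¹ to the proposed image of T_i gives θ_i = (1 + s_i) d_i, where d_i =
k_i⁻¹ + c_i and c_i is the given rational function in e^{a_i}. Since d_i + s_i(d_i) = k_i + k_i⁻¹,
one gets θ_i² = (k_i + k_i⁻¹) θ_i, which is the quadratic relation. For m_ij = 2 the θ's commute.
For m_ij = 3, 4, 6 the braid relation says that a certain combination of alternating products, such
as θ_i θ_j θ_i - θ_i for m_ij = 3, is symmetric in i and j. In the twisted group algebra this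
combination equals (∑ w) ∏ d_α, with w in the dihedral group of s_i, s_j and one factor d_α for each
of its reflections (`kl_three`, `kl_four`, `kl_six`); that expression is visibly symmetric.
Comparing coefficients reduces the claim to identities between rational functions of types A₂, B₂
and G₂.

Injectivity. By Matsumoto's theorem the products T_w along reduced words depend only on w, and they
span the Hecke algebra (`span_wordProd_heckeT`). The image of T_w is a nonzero multiple of w plus
terms supported on shorter elements, so these images are linearly independent
(`linearIndependent_wordProd`).

Matsumoto's theorem rests on the exchange condition, which follows from the fact that the
coordinates of an affine root in the basis Δ all have one sign (`coord_nonneg_or_nonpos`). This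
comes from the geometry of the chamber: each a_i is bounded on it because W contains enough
translations, so the constant function 1 is a strictly positive combination of the a_i.

Uniqueness holds because the T_i generate the Hecke algebra. -/

theorem typeA_identity {K : Type*} [Field K] {k x y A B C : K} (hk : k ≠ 0) (h1 : 1 - x ≠ 0)
    (h2 : 1 - y ≠ 0) (h3 : 1 - x * y ≠ 0) (hA : A = (k - k⁻¹ * x) / (1 - x))
    (hB : B = (k - k⁻¹ * y) / (1 - y)) (hC : C = (k - k⁻¹ * (x * y)) / (1 - x * y)) :
    A * B + (k + k⁻¹ - A) * C - B * C = 1 := by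
  subst hA hB hC
  field_simp
  ring

/-- Here x belongs to the root whose double may again be a root, so its function carries a second
parameter u; the function of y carries only l. The identity is the coefficient comparison at 1 in
`kl_four`. -/
theorem typeB_identity {K : Type*} [Field K] {k l u x y A B A1 B1 : K} (hk : k ≠ 0) (hl : l ≠ 0)
    (hu : u ≠ 0) (h1 : 1 - x ^ 2 ≠ 0) (h2 : 1 - y ≠ 0) (h3 : 1 - x ^ 2 * y ^ 2 ≠ 0)
    (h4 : 1 - x ^ 2 * y ≠ 0) (hA : A = (k + (u - u⁻¹) * x - k⁻¹ * x ^ 2) / (1 - x ^ 2))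
    (hB : B = (l - l⁻¹ * y) / (1 - y))
    (hA1 : A1 = (k + (u - u⁻¹) * (x * y) - k⁻¹ * (x ^ 2 * y ^ 2)) / (1 - x ^ 2 * y ^ 2))
    (hB1 : B1 = (l - l⁻¹ * (x ^ 2 * y)) / (1 - x ^ 2 * y)) :
    A * B + (k + k⁻¹ - A) * B1 + (l + l⁻¹ - B) * A1 - (k * l⁻¹ + l * k⁻¹) = A1 * B1 := by
  subst hA hB hA1 hB1
  field_simp
  ring

section TypeG

variable {K : Type*} [Field K] {k l x y A B A1 B1 A2 B2 : K}

/-- This and `typeG_identity_long` are the coefficient comparison at the middle coset in `kl_six`.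
Two versions are needed because that lemma is used for (s, t) and for (t, s), and the short and long
roots are not interchangeable. -/
theorem typeG_identity_short (hk : k ≠ 0) (hl : l ≠ 0) (h1 : 1 - x ≠ 0) (h2 : 1 - y ≠ 0)
    (h3 : 1 - x * y ≠ 0) (h4 : 1 - x ^ 2 * y ≠ 0) (h5 : 1 - x ^ 3 * y ≠ 0)
    (h6 : 1 - x ^ 3 * y ^ 2 ≠ 0) (hA : A = (k - k⁻¹ * x) / (1 - x))
    (hB : B = (l - l⁻¹ * y) / (1 - y)) (hA1 : A1 = (k - k⁻¹ * (x * y)) / (1 - x * y))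
    (hA2 : A2 = (k - k⁻¹ * (x ^ 2 * y)) / (1 - x ^ 2 * y))
    (hB1 : B1 = (l - l⁻¹ * (x ^ 3 * y)) / (1 - x ^ 3 * y))
    (hB2 : B2 = (l - l⁻¹ * (x ^ 3 * y ^ 2)) / (1 - x ^ 3 * y ^ 2)) :
    A * B + (k + k⁻¹ - A) * B1 + ((k + k⁻¹ - A1) * B2 + A1 * (l + l⁻¹ - B)
      + (l + l⁻¹ - B2) * A2) - 2 * (k * l⁻¹ + l * k⁻¹) = A2 * B1 := by
  subst hA hB hA1 hB1 hA2 hB2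
  field_simp
  ring

theorem typeG_identity_long (hk : k ≠ 0) (hl : l ≠ 0) (h1 : 1 - x ≠ 0) (h2 : 1 - y ≠ 0)
    (h3 : 1 - x * y ≠ 0) (h4 : 1 - x ^ 2 * y ≠ 0) (h5 : 1 - x ^ 3 * y ≠ 0)
    (h6 : 1 - x ^ 3 * y ^ 2 ≠ 0) (hA : A = (k - k⁻¹ * x) / (1 - x))
    (hB : B = (l - l⁻¹ * y) / (1 - y)) (hA1 : A1 = (k - k⁻¹ * (x * y)) / (1 - x * y))
    (hA2 : A2 = (k - k⁻¹ * (x ^ 2 * y)) / (1 - x ^ 2 * y))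
    (hB1 : B1 = (l - l⁻¹ * (x ^ 3 * y)) / (1 - x ^ 3 * y))
    (hB2 : B2 = (l - l⁻¹ * (x ^ 3 * y ^ 2)) / (1 - x ^ 3 * y ^ 2)) :
    A * B + (l + l⁻¹ - B) * A1 + ((l + l⁻¹ - B1) * A2 + B1 * (k + k⁻¹ - A)
      + (k + k⁻¹ - A2) * B2) - 2 * (k * l⁻¹ + l * k⁻¹) = A1 * B2 := by
  subst hA hB hA1 hB1 hA2 hB2
  field_simp
  ring

/-- A polynomial consequence of the relations between the functions `1 / (1 - e^α)`, for `α`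
positive in a root system of type `G₂`. -/
theorem typeG_quartic {k m l n a a1 a2 b b1 b2 : K}
    (r1 : a * b = a1 * (a + b - 1)) (r2 : a * a1 = a2 * (a + a1 - 1))
    (r3 : a * a2 = b1 * (a + a2 - 1)) (r4 : b * b1 = b2 * (b + b1 - 1))
    (r5 : a1 * a2 = b2 * (a1 + a2 - 1))
    {A A1 A2 B B1 B2 A' A1' B' B1' : K}
    (hA : A = m + (k - m) * a) (hA1 : A1 = m + (k - m) * a1) (hA2 : A2 = m + (k - m) * a2)
    (hB : B = n + (l - n) * b) (hB1 : B1 = n + (l - n) * b1) (hB2 : B2 = n + (l - n) * b2)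
    (hA' : A' = k - (k - m) * a) (hA1' : A1' = k - (k - m) * a1)
    (hB' : B' = l - (l - n) * b) (hB1' : B1' = l - (l - n) * b1) :
    (A * B + A' * B1 + B' * A1) * (A * B + A' * B1)
      + B' * A1 * (A1 * B' + A1' * B2 + B * A) + A' * B1' * A2 * B1
      - 2 * (k * n + l * m) * (A * B + A' * B1 + B' * A1)
      + ((k * n + l * m) ^ 2 - k * m * l * n) = A1 * A2 * B1 * B2 := by
  subst hA hA1 hA2 hB hB1 hB2 hA' hA1' hB' hB1'
  -- With m and n in place of k⁻¹ and l⁻¹ the claim is polynomial. The coefficients below exhibit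
  -- the difference of the two sides as an element of the ideal generated by the relations `r1`, …,
  -- `r5`.
  linear_combination
    ((2*m^2*l*n - m^2*n^2 - 4*k*m*l*n + 2*k*m*n^2 - k^2*l^2 + 2*k^2*l*n + 2*k*m*l^2 - k^2*n^2 -
    m^2*l^2)*a1*b + (2*m^2*l*n - m^2*n^2 - 4*k*m*l*n + 2*k*m*n^2 - k^2*l^2 + 2*k^2*l*n +
    2*k*m*l^2 - k^2*n^2 - m^2*l^2)*a1*a2 + (- 2*m^2*l*n + m^2*n^2 + 4*k*m*l*n - 2*k*m*n^2 +
    k^2*l^2 - 2*k^2*l*n - 2*k*m*l^2 + k^2*n^2 + m^2*l^2)*a*b + (4*m^2*l*n - 2*m^2*n^2 -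
    8*k*m*l*n + 4*k*m*n^2 - 2*k^2*l^2 + 4*k^2*l*n + 4*k*m*l^2 - 2*k^2*n^2 - 2*m^2*l^2)*a*b1 + (-
    2*m^2*l*n + m^2*n^2 + 4*k*m*l*n - 2*k*m*n^2 + k^2*l^2 - 2*k^2*l*n - 2*k*m*l^2 + k^2*n^2 +
    m^2*l^2)*a*a1 + (- 2*m^2*l*n + m^2*n^2 + 2*k*m*l*n - k*m*n^2 - k*m*l^2 + m^2*l^2)*a2 + (-
    m^2*l*n + 2*k*m*l*n + k^2*l^2 - k^2*l*n - 2*k*m*l^2 + m^2*l^2)*a1 + (- m^2*l*n + m^2*n^2 +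
    k*m*l*n - k*m*n^2)*1 + (4*k*m*l*n - 2*k*m*n^2 + 2*k^2*l^2 - 4*k^2*l*n - 2*k*m*l^2 +
    2*k^2*n^2)*b1) * r1 + ((2*m^2*l*n - m^2*n^2 - 4*k*m*l*n + 2*k*m*n^2 - k^2*l^2 + 2*k^2*l*n +
    2*k*m*l^2 - k^2*n^2 - m^2*l^2)*a*b1 + (- 2*m^2*l*n + m^2*n^2 + 4*k*m*l*n - 2*k*m*n^2 +
    k^2*l^2 - 2*k^2*l*n - 2*k*m*l^2 + k^2*n^2 + m^2*l^2)*a*a1 + (m^2*l*n - m^2*n^2 - 2*k*m*l*n +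
    2*k*m*n^2 + k^2*l*n - k^2*n^2)*a1 + (m^2*n^2 - k*m*l*n - k*m*n^2 + k^2*l*n)*1 + (2*k*m*l*n -
    k*m*n^2 + k^2*l^2 - 2*k^2*l*n - k*m*l^2 + k^2*n^2)*b1) * r2 + ((- 2*m^2*l*n + m^2*n^2 +
    4*k*m*l*n - 2*k*m*n^2 + k^2*l^2 - 2*k^2*l*n - 2*k*m*l^2 + k^2*n^2 + m^2*l^2)*a1*b +
    (2*m^2*l*n - m^2*n^2 - 4*k*m*l*n + 2*k*m*n^2 - k^2*l^2 + 2*k^2*l*n + 2*k*m*l^2 - k^2*n^2 -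
    m^2*l^2)*a*b1 + (- 2*m^2*l*n + m^2*n^2 + 4*k*m*l*n - 2*k*m*n^2 + k^2*l^2 - 2*k^2*l*n -
    2*k*m*l^2 + k^2*n^2 + m^2*l^2)*a*a1 + (2*m^2*l*n - m^2*n^2 - 2*k*m*l*n + k*m*n^2 + k*m*l^2 -
    m^2*l^2)*b + (m^2*l*n - m^2*n^2 - 4*k*m*l*n + 3*k*m*n^2 - k^2*l^2 + 3*k^2*l*n + k*m*l^2 -
    2*k^2*n^2)*a1 + (- m^2*l*n + m^2*n^2 + k*m*l*n - k*m*n^2)*1 + (2*k*m*l*n - k*m*n^2 + k^2*l^2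
    - 2*k^2*l*n - k*m*l^2 + k^2*n^2)*b1) * r3 + ((- 2*m^2*l*n + m^2*n^2 + 4*k*m*l*n - 2*k*m*n^2
    + k^2*l^2 - 2*k^2*l*n - 2*k*m*l^2 + k^2*n^2 + m^2*l^2)*a1*a2 + (2*m^2*l*n - m^2*n^2 -
    2*k*m*l*n + k*m*n^2 + k*m*l^2 - m^2*l^2)*a2 + (2*m^2*l*n - m^2*n^2 - 2*k*m*l*n + k*m*n^2 +
    k*m*l^2 - m^2*l^2)*a1 + (- 2*m^2*l*n + m^2*n^2 + m^2*l^2)*1) * r4 + ((2*m^2*l*n - m^2*n^2 -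
    4*k*m*l*n + 2*k*m*n^2 - k^2*l^2 + 2*k^2*l*n + 2*k*m*l^2 - k^2*n^2 - m^2*l^2)*a1*b + (-
    2*m^2*l*n + m^2*n^2 + 2*k*m*l*n - k*m*n^2 - k*m*l^2 + m^2*l^2)*b + (- m^2*l*n + 2*k*m*l*n +
    k^2*l^2 - k^2*l*n - 2*k*m*l^2 + m^2*l^2)*a1 + (m^2*l*n - k*m*l*n + k*m*l^2 - m^2*l^2)*1) *
    r5

/-- The five instances used below are the additive relations between positive roots of G₂: with x
short and y long, the other positive roots are xy, x²y, x³y, x³y². -/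
theorem one_div_one_sub_mul {z : K} (h1 : 1 - x ≠ 0) (h2 : 1 - y ≠ 0) (h3 : 1 - z ≠ 0)
    (hz : z = x * y) : 1 / (1 - x) * (1 / (1 - y))
      = 1 / (1 - z) * (1 / (1 - x) + 1 / (1 - y) - 1) := by
  subst hz
  field_simp
  ring

theorem typeG_identity_quartic (hk : k ≠ 0) (hl : l ≠ 0) (h1 : 1 - x ≠ 0) (h2 : 1 - y ≠ 0)
    (h3 : 1 - x * y ≠ 0) (h4 : 1 - x ^ 2 * y ≠ 0) (h5 : 1 - x ^ 3 * y ≠ 0)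
    (h6 : 1 - x ^ 3 * y ^ 2 ≠ 0) (hA : A = (k - k⁻¹ * x) / (1 - x))
    (hB : B = (l - l⁻¹ * y) / (1 - y)) (hA1 : A1 = (k - k⁻¹ * (x * y)) / (1 - x * y))
    (hA2 : A2 = (k - k⁻¹ * (x ^ 2 * y)) / (1 - x ^ 2 * y))
    (hB1 : B1 = (l - l⁻¹ * (x ^ 3 * y)) / (1 - x ^ 3 * y))
    (hB2 : B2 = (l - l⁻¹ * (x ^ 3 * y ^ 2)) / (1 - x ^ 3 * y ^ 2)) :
    (A * B + (k + k⁻¹ - A) * B1 + (l + l⁻¹ - B) * A1) * (A * B + (k + k⁻¹ - A) * B1)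
      + (l + l⁻¹ - B) * A1 * (A1 * (l + l⁻¹ - B) + (k + k⁻¹ - A1) * B2 + B * A)
      + (k + k⁻¹ - A) * (l + l⁻¹ - B1) * A2 * B1
      - 2 * (k * l⁻¹ + l * k⁻¹) * (A * B + (k + k⁻¹ - A) * B1 + (l + l⁻¹ - B) * A1)
      + ((k * l⁻¹ + l * k⁻¹) ^ 2 - 1) = A1 * A2 * B1 * B2 := by
  have key := typeG_quartic (k := k) (m := k⁻¹) (l := l) (n := l⁻¹) (a := 1 / (1 - x))
    (a1 := 1 / (1 - x * y)) (a2 := 1 / (1 - x ^ 2 * y)) (b := 1 / (1 - y))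
    (b1 := 1 / (1 - x ^ 3 * y)) (b2 := 1 / (1 - x ^ 3 * y ^ 2))
    (one_div_one_sub_mul h1 h2 h3 rfl) (one_div_one_sub_mul h1 h3 h4 (by ring))
    (one_div_one_sub_mul h1 h4 h5 (by ring)) (one_div_one_sub_mul h2 h5 h6 (by ring))
    (one_div_one_sub_mul h3 h4 h6 (by ring)) (A := A) (A1 := A1) (A2 := A2) (B := B) (B1 := B1) (B2 := B2)
    (A' := k + k⁻¹ - A) (A1' := k + k⁻¹ - A1) (B' := l + l⁻¹ - B) (B1' := l + l⁻¹ - B1)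
    (by rw [hA]; field_simp; ring) (by rw [hA1]; field_simp; ring)
    (by rw [hA2]; field_simp; ring) (by rw [hB]; field_simp; ring)
    (by rw [hB1]; field_simp; ring) (by rw [hB2]; field_simp; ring)
    (by rw [hA]; field_simp; ring) (by rw [hA1]; field_simp; ring)
    (by rw [hB]; field_simp; ring) (by rw [hB1]; field_simp; ring)
  rwa [mul_inv_cancel₀ hk, one_mul, mul_inv_cancel₀ hl] at key

end TypeG

end RankTwo

/-! ### Braid relations from Kazhdan–Lusztig type relations -/

namespace RankTwo

section Braid

variable {𝕜 A : Type*} [Field 𝕜] [Ring A] [Algebra 𝕜 A]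

/-- With S = P - k⁻¹ and T = Q - k⁻¹, the braid relation expands to `h` modulo the quadratic
relations for P and Q. The same holds in `braid_four` and `braid_six`. For equal parameters the
coefficients are those of the Chebyshev polynomials X² - 1, X³ - 2X and X⁵ - 4X³ + 3X. -/
theorem braid_three {k : 𝕜} (hk : k ≠ 0) {S T P Q : A} (hS : S = P - k⁻¹ • 1)
    (hT : T = Q - k⁻¹ • 1) (hP : P * P = (k + k⁻¹) • P) (hQ : Q * Q = (k + k⁻¹) • Q)
    (h : P * (Q * P) - P = Q * (P * Q) - Q) : S * (T * S) = T * (S * T) := by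
  have h' : P * (Q * P) = Q * (P * Q) - Q + P := by rw [← h]; abel
  subst hS hT
  simp only [mul_sub, sub_mul, mul_smul_comm, smul_mul_assoc, mul_one, one_mul, hP, hQ, h']
  match_scalars <;> field_simp <;> ring

theorem braid_four {k l : 𝕜} (hk : k ≠ 0) (hl : l ≠ 0) {S T P Q : A} (hS : S = P - k⁻¹ • 1)
    (hT : T = Q - l⁻¹ • 1) (hP : P * P = (k + k⁻¹) • P) (hQ : Q * Q = (l + l⁻¹) • Q)
    (h : P * (Q * (P * Q)) - (k * l⁻¹ + l * k⁻¹) • (P * Q)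
      = Q * (P * (Q * P)) - (k * l⁻¹ + l * k⁻¹) • (Q * P)) :
    S * (T * (S * T)) = T * (S * (T * S)) := by
  have h' : P * (Q * (P * Q)) = Q * (P * (Q * P)) - (k * l⁻¹ + l * k⁻¹) • (Q * P)
      + (k * l⁻¹ + l * k⁻¹) • (P * Q) := by rw [← h]; abel
  have hP' (x : A) : P * (P * x) = (k + k⁻¹) • (P * x) := by rw [← mul_assoc, hP, smul_mul_assoc]
  have hQ' (x : A) : Q * (Q * x) = (l + l⁻¹) • (Q * x) := by rw [← mul_assoc, hQ, smul_mul_assoc]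
  subst hS hT
  simp only [mul_sub, sub_mul, mul_smul_comm, smul_mul_assoc, mul_one, one_mul, hP, hQ, hP', hQ',
    h']
  match_scalars <;> field_simp <;> ring

theorem braid_six {k l : 𝕜} (hk : k ≠ 0) (hl : l ≠ 0) {S T P Q : A} (hS : S = P - k⁻¹ • 1)
    (hT : T = Q - l⁻¹ • 1) (hP : P * P = (k + k⁻¹) • P) (hQ : Q * Q = (l + l⁻¹) • Q)
    (h : P * (Q * (P * (Q * (P * Q)))) - (2 * (k * l⁻¹ + l * k⁻¹)) • (P * (Q * (P * Q)))
        + ((k * l⁻¹ + l * k⁻¹) ^ 2 - 1) • (P * Q)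
      = Q * (P * (Q * (P * (Q * P)))) - (2 * (k * l⁻¹ + l * k⁻¹)) • (Q * (P * (Q * P)))
        + ((k * l⁻¹ + l * k⁻¹) ^ 2 - 1) • (Q * P)) :
    S * (T * (S * (T * (S * T)))) = T * (S * (T * (S * (T * S)))) := by
  have h' : P * (Q * (P * (Q * (P * Q)))) = Q * (P * (Q * (P * (Q * P))))
      - (2 * (k * l⁻¹ + l * k⁻¹)) • (Q * (P * (Q * P)))
      + ((k * l⁻¹ + l * k⁻¹) ^ 2 - 1) • (Q * P)
      + (2 * (k * l⁻¹ + l * k⁻¹)) • (P * (Q * (P * Q)))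
      - ((k * l⁻¹ + l * k⁻¹) ^ 2 - 1) • (P * Q) := by rw [← h]; abel
  have hP' (x : A) : P * (P * x) = (k + k⁻¹) • (P * x) := by rw [← mul_assoc, hP, smul_mul_assoc]
  have hQ' (x : A) : Q * (Q * x) = (l + l⁻¹) • (Q * x) := by rw [← mul_assoc, hQ, smul_mul_assoc]
  subst hS hT
  simp only [mul_sub, sub_mul, mul_smul_comm, smul_mul_assoc, mul_one, one_mul, hP, hQ, hP', hQ',
    h']
  match_scalars <;> field_simp <;> ring

end Braid

/-! ### Kazhdan–Lusztig elements in a twisted group algebra of a dihedral group -/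

section Twisted

variable {𝕜 G K R : Type*} [Field 𝕜] [Group G] [Field K] [Algebra 𝕜 K] [MulSemiringAction G K]
  [Ring R] [Algebra 𝕜 R] (c : K →ₐ[𝕜] R) (u : G →* R)

/-- The element `(1 + s) h w (1 + t)`. -/
def bracket (s t : G) (h : K) (w : G) : R := (1 + u s) * c h * u w * (1 + u t)

variable {c u} {s t : G}

theorem bracket_add (h h' : K) (w : G) :
    bracket c u s t (h + h') w = bracket c u s t h w + bracket c u s t h' w := by
  simp only [bracket, map_add]; noncomm_ring

theorem bracket_sub (h h' : K) (w : G) :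
    bracket c u s t (h - h') w = bracket c u s t h w - bracket c u s t h' w := by
  simp only [bracket, map_sub]; noncomm_ring

theorem bracket_smul (r : 𝕜) (h : K) (w : G) :
    bracket c u s t (r • h) w = r • bracket c u s t h w := by
  simp only [bracket, map_smul, mul_smul_comm, smul_mul_assoc]

/-- A bracket sees w only through its coset modulo t on the right, and a factor s on the left of w
can be moved onto h (`bracket_mul_left`). So brackets in a dihedral group are indexed by very few
group elements, which keeps the expansions below short. -/
theorem bracket_mul_right (ht : t * t = 1) (h : K) (w : G) :
    bracket c u s t h (w * t) = bracket c u s t h w := by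
  have : u t * u t = 1 := by rw [← map_mul, ht, map_one]
  simp only [bracket, map_mul, mul_assoc, mul_add, mul_one, this]
  abel_nf

theorem bracket_self (ht : t * t = 1) (h : K) : bracket c u s t h t = bracket c u s t h 1 := by
  rw [← bracket_mul_right ht h 1, one_mul]

variable (hc : ∀ g f, u g * c f = c (g • f) * u g) (hs : s * s = 1)
include hc hs

theorem one_add_mul_mul (h : K) :
    (1 + u s) * (c h * u s) = (1 + u s) * c (s • h) := by
  have h1 : u s * u s = 1 := by rw [← map_mul, hs, map_one]
  have h2 : (1 + u s) * u s = 1 + u s := by rw [add_mul, h1, one_mul, add_comm]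
  have h3 : c h * u s = u s * c (s • h) := by rw [hc, ← mul_smul, hs, one_smul]
  rw [h3, ← mul_assoc, h2]

theorem bracket_mul_left (h : K) (w : G) :
    bracket c u s t h (s * w) = bracket c u s t (s • h) w := by
  simp only [bracket, map_mul]
  rw [← mul_assoc _ (u s), mul_assoc _ (c h), one_add_mul_mul hc hs]

/-- Moving all of K to the left of the group elements produces the terms 1, s, t and ts behind the
leading factor 1 + s. The term in s is absorbed by that factor, at the price of applying s to its
coefficient. -/
theorem mul_mul_expand (d e h : K) :
    (1 + u s) * c d * ((1 + u t) * c e) * ((1 + u s) * c h)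
      = (1 + u s) * (c (d * e * h + s • (d * e) * h) + c (d * (t • e) * (t • h)) * u t
        + c (d * (t • e) * (t • s • h)) * u (t * s)) := by
  have h0 : s • (d * e) * h = s • ((d * e) * s • h) := by
    simp only [smul_mul', ← mul_smul, hs, one_smul]
  have e1 : c d * ((1 + u t) * c e) = c (d * e) + c (d * t • e) * u t := by
    rw [add_mul, hc, one_mul, mul_add, map_mul, map_mul, mul_assoc]
  have e2 : (1 + u s) * c h = c h + c (s • h) * u s := by rw [add_mul, hc, one_mul]
  rw [h0, map_add c, mul_add, mul_add, mul_add, ← one_add_mul_mul hc hs, mul_assoc (1 + u s),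
    mul_assoc (1 + u s), e1, e2, ← mul_add, ← mul_add, ← mul_add]
  congr 1
  rw [add_mul, mul_add, mul_add]
  have e3 (x : K) (y : R) : c (d * t • e) * u t * (c x * y) = c (d * t • e * t • x) * (u t * y) := by
    rw [mul_assoc, ← mul_assoc (u t), hc, map_mul _ (d * t • e)]
    simp only [mul_assoc]
  have e4 (x : K) : c (d * t • e) * u t * c x = c (d * t • e * t • x) * u t := by
    rw [mul_assoc, hc, map_mul _ (d * t • e), mul_assoc]
  rw [e3, e4, ← mul_assoc (c (d * e)), ← map_mul, ← map_mul, ← map_mul u]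
  abel

theorem mul_bracket (d e h : K) (w : G) :
    (1 + u s) * c d * ((1 + u t) * c e) * bracket c u s t h w
      = bracket c u s t (d * e * h + s • (d * e) * h) w
        + bracket c u s t (d * (t • e) * (t • h)) (t * w)
        + bracket c u s t (d * (t • e) * (t • s • h)) (t * s * w) := by
  have := mul_mul_expand (t := t) hc hs d e h
  simp only [bracket, map_mul u]
  rw [← mul_assoc, ← mul_assoc, this, map_mul]
  simp only [mul_add, add_mul, mul_assoc, map_mul u]
  abel

/-- Since (1 + s) absorbs s, the product d (1 + s) d may be replaced by (d + s • d) d, and d + s • d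
is the scalar k. -/
theorem twisted_sq {k : 𝕜} {d : K} (hd : s • d = algebraMap 𝕜 K k - d) :
    (1 + u s) * c d * ((1 + u s) * c d) = k • ((1 + u s) * c d) := by
  have h1 : c d * ((1 + u s) * c d) = c (d * d) + c (d * s • d) * u s := by
    rw [add_mul, one_mul, mul_add, hc, map_mul, map_mul, mul_assoc]
  have h2 : k • c d = c (algebraMap 𝕜 K k * d) := by
    rw [← Algebra.smul_def]; exact (map_smul c k d).symm
  rw [mul_assoc, h1, mul_add, one_add_mul_mul hc hs, ← mul_add, ← map_add,
    ← mul_smul_comm k (1 + u s), h2, smul_mul', ← mul_smul, hs, one_smul, hd]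
  congr 2
  ring

omit hs in
theorem kl_two (hst : s * t = t * s) {d e : K} (hd : t • d = d) (he : s • e = e) :
    (1 + u s) * c d * ((1 + u t) * c e) = (1 + u t) * c e * ((1 + u s) * c d) := by
  have h1 : u s * u t = u t * u s := by rw [← map_mul, hst, map_mul]
  have h2 : c d * (1 + u t) = (1 + u t) * c d := by rw [mul_add, add_mul, hc, hd]; simp
  have h3 : c e * (1 + u s) = (1 + u s) * c e := by rw [mul_add, add_mul, hc, he]; simp
  rw [mul_assoc, ← mul_assoc (c d), h2, mul_assoc (1 + u t) (c e), ← mul_assoc (c e), h3,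
    mul_assoc (1 + u t) (c d), mul_assoc (1 + u s) (c e), ← map_mul, ← map_mul, mul_comm d e,
    ← mul_assoc, ← mul_assoc]
  congr 1
  simp only [add_mul, mul_add, one_mul, mul_one, h1]
  abel

/-- The right-hand side is the sum of all six elements of the dihedral group times the product of
the functions of the three positive roots. Apart from the order of A and B it does not change when s
and t are interchanged. -/
theorem kl_three {q A B C : K}
    (sA : s • A = q - A) (sB : s • B = C) (tA : t • A = C) (tB : t • B = q - B)
    (sC : s • C = B) (tC : t • C = A) (tq : t • q = q) (key : A * B + (q - A) * C - B * C = 1) :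
    (1 + u s) * c A * ((1 + u t) * c B * ((1 + u s) * c A)) - (1 + u s) * c A
      = (1 + u s) * (1 + u t + u (t * s)) * c (A * B * C) := by
  have e (x : R) : (1 + u t + u (t * s)) * x = x + u t * x + u (t * s) * x := by noncomm_ring
  rw [← mul_assoc, mul_mul_expand hc hs, ← mul_sub, mul_assoc (1 + u s), e, hc, hc,
    add_sub_right_comm, add_sub_right_comm, ← map_sub, mul_smul t s]
  simp only [smul_mul', smul_sub, sA, sB, sC, tA, tB, tC, tq]
  refine congrArg ((1 + u s) * ·) (congrArg₂ _ (congrArg₂ _ (congrArg c ?_)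
    (congrArg (c · * u t) ?_)) (congrArg (c · * u (t * s)) ?_))
  -- Only the coefficient of 1 uses the rational identity; those of t and ts agree after commuting
  -- factors.
  · linear_combination A * key
  · ring
  · ring

variable (ht : t * t = 1)
include ht

-- A t-invariant factor passes through 1 + t, so the expected answer becomes a sum of brackets that
-- can be compared coset by coset.
omit hs ht in
theorem mul_bracket_coset {f : K} (hf : t • f = f) (w : G) :
    (1 + u s) * u w * (1 + u t) * c f = bracket c u s t (w • f) w := by
  have : (1 + u t) * c f = c f * (1 + u t) := by rw [add_mul, hc, hf, mul_add]; simp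
  rw [mul_assoc, this, ← mul_assoc, mul_assoc _ (u w), hc, bracket]
  simp only [mul_assoc]

/-- After splitting off B on the right, every term is a bracket at 1 or at ts. The first yields the
rational identity and the second is formal. The factor (1 + s)(1 + ts)(1 + t) is the sum over the
dihedral group of order 8. -/
theorem kl_four {r : 𝕜} {p q A B A1 B1 : K}
    (sA : s • A = p - A) (sB : s • B = B1) (tA : t • A = A1) (tB : t • B = q - B)
    (sA1 : s • A1 = A1) (tA1 : t • A1 = A) (sB1 : s • B1 = B) (tB1 : t • B1 = B1)
    (tp : t • p = p)
    (key : A * B + (p - A) * B1 + (q - B) * A1 - algebraMap 𝕜 K r = A1 * B1) :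
    (1 + u s) * c A * ((1 + u t) * c B) * ((1 + u s) * c A * ((1 + u t) * c B))
      - r • ((1 + u s) * c A * ((1 + u t) * c B))
      = (1 + u s) * (1 + u (t * s)) * (1 + u t) * c (A * B * A1 * B1) := by
  have e0 : (1 + u s) * c A * ((1 + u t) * c B) = bracket c u s t A 1 * c B := by
    simp only [bracket, map_one, mul_one, mul_assoc]
  have hf : t • (A * A1 * B1) = A * A1 * B1 := by
    simp only [smul_mul', tA, tA1, tB1]; ring
  have e1 := mul_bracket_coset (s := s) hc hf 1
  have e2 := mul_bracket_coset (s := s) hc hf (t * s)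
  have e3 := mul_bracket (t := t) hc hs A B A 1
  have e4 (x y z w : R) : x * (1 + y) * z * w = x * z * w + x * y * z * w := by noncomm_ring
  rw [map_one, mul_one, one_smul] at e1
  rw [show A * B * A1 * B1 = A * A1 * B1 * B by ring, map_mul c _ B,
    ← mul_assoc _ (c (A * A1 * B1)), e4 (1 + u s) (u (t * s)) (1 + u t), e1, e2]
  rw [mul_one, mul_one, bracket_self ht, ← bracket_add] at e3
  nth_rewrite 2 [e0]
  rw [← mul_assoc _ (bracket c u s t A 1), e3, e0, ← smul_mul_assoc r, ← sub_mul, ← bracket_smul, mul_smul t s,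
    Algebra.smul_def]
  congr 1
  simp only [smul_mul', smul_sub, sA, sB, sA1, sB1, tA, tB, tA1, tp]
  rw [add_sub_right_comm, ← bracket_sub]
  refine congrArg₂ _ (congrArg (bracket c u s t · 1) ?_) (congrArg (bracket c u s t · (t * s)) ?_)
  · linear_combination A * key
  · ring

/-- This follows `kl_four` with brackets at 1, ts and tsts: `key4` settles the first, `key2` the
second, and the third is formal. The factor on the right is the sum over the dihedral group of order
12. -/
theorem kl_six {b d : 𝕜} {p q A B A1 B1 A2 B2 : K}
    (sA : s • A = p - A) (sA1 : s • A1 = A2) (sA2 : s • A2 = A1)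
    (sB : s • B = B1) (sB1 : s • B1 = B) (sB2 : s • B2 = B2)
    (tA : t • A = A1) (tA1 : t • A1 = A) (tA2 : t • A2 = A2)
    (tB : t • B = q - B) (tB1 : t • B1 = B2) (tB2 : t • B2 = B1)
    (tp : t • p = p) (sp : s • p = p) (sq : s • q = q) (tq : t • q = q)
    (key2 : A * B + (p - A) * B1 + ((p - A1) * B2 + A1 * (q - B) + (q - B2) * A2)
      - algebraMap 𝕜 K b = A2 * B1)
    (key4 : (A * B + (p - A) * B1 + (q - B) * A1) * (A * B + (p - A) * B1)
      + (q - B) * A1 * (A1 * (q - B) + (p - A1) * B2 + B * A)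
      + (p - A) * (q - B1) * A2 * B1
      - algebraMap 𝕜 K b * (A * B + (p - A) * B1 + (q - B) * A1)
      + algebraMap 𝕜 K d = A1 * A2 * B1 * B2) :
    (1 + u s) * c A * ((1 + u t) * c B) * ((1 + u s) * c A * ((1 + u t) * c B) *
        ((1 + u s) * c A * ((1 + u t) * c B)))
      - b • ((1 + u s) * c A * ((1 + u t) * c B) * ((1 + u s) * c A * ((1 + u t) * c B)))
      + d • ((1 + u s) * c A * ((1 + u t) * c B))
      = (1 + u s) * (1 + u (t * s) + u (t * s * (t * s))) * (1 + u t)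
        * c (A * B * A1 * B1 * A2 * B2) := by
  obtain ⟨z, hz⟩ : ∃ z, z = (1 + u s) * c A * ((1 + u t) * c B) := ⟨_, rfl⟩
  have e0 : z = bracket c u s t A 1 * c B := by
    simp only [hz, bracket, map_one, mul_one, mul_assoc]
  have hf : t • (A * A1 * A2 * B1 * B2) = A * A1 * A2 * B1 * B2 := by
    simp only [smul_mul', tA, tA1, tA2, tB1, tB2]; ring
  have e1 := mul_bracket_coset (s := s) hc hf 1
  have e2 := mul_bracket_coset (s := s) hc hf (t * s)
  have e2' := mul_bracket_coset (s := s) hc hf (t * s * (t * s))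
  rw [map_one, mul_one, one_smul] at e1
  have e3 := mul_bracket (t := t) hc hs A B A 1
  rw [mul_one, mul_one, bracket_self ht, ← bracket_add, ← hz] at e3
  have e4 := mul_bracket (t := t) hc hs A B
    (A * B * A + s • (A * B) * A + A * (t • B) * (t • A)) 1
  rw [mul_one, mul_one, bracket_self ht, ← bracket_add, ← hz] at e4
  have e5 := mul_bracket (t := t) hc hs A B (A * (t • B) * (t • s • A)) (t * s)
  have e6 (x y y' z w : R) :
      x * (1 + y + y') * z * w = x * z * w + x * y * z * w + x * y' * z * w := by noncomm_ring
  -- The middle term at w = ts has group element t · ts = s, which falls back to the bracket at 1.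
  have ets : t * (t * s) = s * 1 := by rw [← mul_assoc, ht, one_mul, mul_one]
  rw [ets, bracket_mul_left hc hs, ← hz] at e5
  rw [show A * B * A1 * B1 * A2 * B2 = A * A1 * A2 * B1 * B2 * B by ring, map_mul c _ B,
    ← mul_assoc _ (c (A * A1 * A2 * B1 * B2)), e6 (1 + u s) (u (t * s)), e1, e2, e2', ← hz]
  have z2 : z * z = z * bracket c u s t A 1 * c B := by rw [mul_assoc z, ← e0]
  rw [z2, e3, ← mul_assoc z, mul_add, e4, e5, e0, ← smul_mul_assoc b, ← smul_mul_assoc d,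
    ← sub_mul, ← add_mul, smul_add b, ← bracket_smul, ← bracket_smul, ← bracket_smul]
  congr 1
  simp only [mul_smul t s, mul_smul (t * s)]
  simp only [Algebra.smul_def, smul_mul', smul_sub, smul_add, sA, sB, sA1, sB1, sA2, sB2, tA, tB,
    tA1, tB1, tA2, tB2, tp, tq, sp, sq]
  have e7 (a x y z f b₁ b₂ d : K) (w w' : G) :
      bracket c u s t a 1 + bracket c u s t x w
        + (bracket c u s t y w + bracket c u s t z 1 + bracket c u s t f w')
        - (bracket c u s t b₁ 1 + bracket c u s t b₂ w) + bracket c u s t d 1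
      = bracket c u s t (a + z - b₁ + d) 1 + bracket c u s t (x + y - b₂) w
        + bracket c u s t f w' := by
    simp only [bracket_add, bracket_sub]
    abel
  rw [e7]
  refine congrArg₂ _ (congrArg₂ _ (congrArg (bracket c u s t · 1) ?_)
    (congrArg (bracket c u s t · (t * s)) ?_)) (congrArg (bracket c u s t · (t * s * (t * s))) ?_)
  · linear_combination A * key4
  · linear_combination A * (q - B) * (p - A1) * key2
  · ring

end Twisted

end RankTwo

/-! ### Reduced words and Matsumoto's theorem

Let `s i` be elements of a group `G`, and let `N w j` be a predicate which behaves like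
"`w⁻¹ a_j` is a negative root". -/

namespace ReducedWord

variable {ι G M : Type*} [Group G] [Monoid M]

/-- The alternating list `i, j, i, …` of length `m`. -/
def altList (i j : ι) : ℕ → List ι
  | 0 => []
  | m + 1 => i :: altList j i m

@[simp]
theorem length_altList (i j : ι) (m : ℕ) : (altList i j m).length = m := by
  induction m generalizing i j with
  | zero => rfl
  | succ m ih => simp [altList, ih]

/-- The product of a word. -/
def wordProd (s : ι → M) (l : List ι) : M := (l.map s).prod

@[simp] theorem wordProd_nil (s : ι → M) : wordProd s [] = 1 := rfl

@[simp] theorem wordProd_cons (s : ι → M) (i : ι) (l : List ι) :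
    wordProd s (i :: l) = s i * wordProd s l := by simp [wordProd]

@[simp] theorem wordProd_append (s : ι → M) (l l' : List ι) :
    wordProd s (l ++ l') = wordProd s l * wordProd s l' := by simp [wordProd]

/-- A word is reduced if no shorter word has the same product. -/
def IsReduced (s : ι → G) (l : List ι) : Prop :=
  ∀ l', wordProd s l' = wordProd s l → l.length ≤ l'.length

theorem isReduced_nil (s : ι → G) : IsReduced s [] := fun _ _ => Nat.zero_le _

theorem exists_isReduced (s : ι → G) (l : List ι) :
    ∃ l', IsReduced s l' ∧ wordProd s l' = wordProd s l := by
  induction h : l.length using Nat.strong_induction_on generalizing l with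
  | _ n ih =>
    by_cases hl : IsReduced s l
    · exact ⟨l, hl, rfl⟩
    · simp only [IsReduced, not_forall, not_le] at hl
      obtain ⟨l', h1, h2⟩ := hl
      obtain ⟨p, h3, h4⟩ := ih _ (h ▸ h2) l' rfl
      exact ⟨p, h3, h4.trans h1⟩

theorem IsReduced.length_eq {s : ι → G} {l l' : List ι} (h : IsReduced s l) (h' : IsReduced s l')
    (e : wordProd s l = wordProd s l') : l.length = l'.length :=
  le_antisymm (h _ e.symm) (h' _ e)

theorem IsReduced.of_length_le {s : ι → G} {l l' : List ι} (h : IsReduced s l)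
    (e : wordProd s l' = wordProd s l) (hl : l'.length ≤ l.length) : IsReduced s l' :=
  fun _ h' => hl.trans (h _ (h'.trans e))

theorem IsReduced.of_cons {s : ι → G} {i : ι} {l : List ι} (h : IsReduced s (i :: l)) :
    IsReduced s l := by
  intro l' h'
  have := h (i :: l') (by simp [h'])
  simpa using this

/-- The formal properties of the predicate "`w⁻¹ a_j` is a negative root". -/
structure DescentSystem (s : ι → G) (N : G → ι → Prop) : Prop where
  mul_self : ∀ i, s i * s i = 1
  not_one : ∀ j, ¬ N 1 j
  mul_left : ∀ w j, N (s j * w) j ↔ ¬ N w j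
  fold : ∀ w i j, ¬ N w j → N (w * s i) j → w * s i = s j * w

namespace DescentSystem

variable {s : ι → G} {N : G → ι → Prop} (D : DescentSystem s N)
include D

/-- The exchange condition. -/
theorem exchange (l : List ι) (j : ι) (h : N (wordProd s l) j) :
    ∃ l₁ i l₂, l = l₁ ++ i :: l₂ ∧ s j * wordProd s l = wordProd s (l₁ ++ l₂) := by
  induction l using List.reverseRecOn with
  | nil => exact absurd h (D.not_one j)
  | append_singleton l i ih =>
    by_cases hl : N (wordProd s l) j
    · obtain ⟨l₁, i', l₂, rfl, h'⟩ := ih hl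
      refine ⟨l₁, i', l₂ ++ [i], by simp, ?_⟩
      rw [wordProd_append, ← mul_assoc, h', ← wordProd_append, List.append_assoc]
    -- The descent first appears at this letter i, so folding turns multiplication by s j on the
    -- left into deletion of i.
    · refine ⟨l, i, [], by simp, ?_⟩
      have := D.fold _ i j hl (by simpa using h)
      simp only [wordProd_append, wordProd_cons, wordProd_nil, mul_one]
      rw [this, ← mul_assoc, D.mul_self, one_mul]

theorem inv_mul_cancel_left (j : ι) (w : G) : s j * (s j * w) = w := by
  rw [← mul_assoc, D.mul_self, one_mul]

/-- If i is not a descent of w, then it is one of s i * w. Exchange applied to a reduced word of s i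
* w then gives a word for w that is shorter by one letter. -/
theorem isReduced_cons_iff {l : List ι} (hl : IsReduced s l) (i : ι) :
    IsReduced s (i :: l) ↔ ¬ N (wordProd s l) i := by
  constructor
  · intro h hN
    obtain ⟨l₁, x, l₂, rfl, h'⟩ := D.exchange l i hN
    have := h (l₁ ++ l₂) (by rw [← h', wordProd_cons])
    simp at this
  · intro hN
    obtain ⟨l', hl', h'⟩ := exists_isReduced s (i :: l)
    have hN' : N (wordProd s l') i := by rw [h', wordProd_cons, D.mul_left]; exact hN
    obtain ⟨l₁, x, l₂, rfl, h''⟩ := D.exchange l' i hN'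
    have h3 := hl (l₁ ++ l₂) (by rw [← h'', h', wordProd_cons, D.inv_mul_cancel_left])
    refine hl'.of_length_le h'.symm ?_
    simp at h3 ⊢
    lia

theorem descent_of_isReduced {l : List ι} {i : ι} (hl : IsReduced s (i :: l)) :
    N (wordProd s (i :: l)) i := by
  rw [wordProd_cons, D.mul_left]
  exact (D.isReduced_cons_iff hl.of_cons i).1 hl

theorem isReduced_altList {m : ι → ι → ℕ∞}
    (hm : ∀ i j, i ≠ j → ∀ n : ℕ, ((n + 1 : ℕ) : ℕ∞) ≤ m i j → ¬ N (wordProd s (altList j i n)) i)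
    (hsymm : ∀ i j, m i j = m j i) {i j : ι} (hij : i ≠ j) {n : ℕ} (hn : (n : ℕ∞) ≤ m i j) :
    IsReduced s (altList i j n) := by
  induction n generalizing i j with
  | zero => exact isReduced_nil s
  | succ n ih =>
    have h := ih hij.symm (hsymm i j ▸ (le_trans (by exact_mod_cast n.le_succ) hn))
    exact (D.isReduced_cons_iff h i).2 (hm i j hij n hn)

/-- An element with both descents i and j has reduced words starting with an alternating word of
every length up to m i j. One prepends i to such a word starting with j and lets exchange delete a
letter; the letter cannot lie in the alternating prefix, as the longer alternating word is itself
reduced. -/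
theorem exists_altList_append {m : ι → ι → ℕ∞}
    (hm : ∀ i j, i ≠ j → ∀ n : ℕ, ((n + 1 : ℕ) : ℕ∞) ≤ m i j → ¬ N (wordProd s (altList j i n)) i)
    (hsymm : ∀ i j, m i j = m j i) {l : List ι} (hl : IsReduced s l) {i j : ι} (hij : i ≠ j)
    (hi : N (wordProd s l) i) (hj : N (wordProd s l) j) {n : ℕ} (hn : (n : ℕ∞) ≤ m i j) :
    ∃ r, IsReduced s (altList i j n ++ r) ∧ wordProd s (altList i j n ++ r) = wordProd s l := by
  induction n generalizing i j with
  | zero => exact ⟨l, hl, rfl⟩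
  | succ n ih =>
    obtain ⟨r, hr, h⟩ := ih hij.symm hj hi (hsymm i j ▸ (le_trans (by exact_mod_cast n.le_succ) hn))
    obtain ⟨l₁, x, l₂, h1, h2⟩ := D.exchange _ i (h ▸ hi)
    have outside {t : List ι} (ht : l₁ = altList j i n ++ t) (ht' : r = t ++ x :: l₂) :
        ∃ r', IsReduced s (altList i j (n + 1) ++ r') ∧
          wordProd s (altList i j (n + 1) ++ r') = wordProd s l := by
      have e : wordProd s (altList i j (n + 1) ++ (t ++ l₂)) = wordProd s (altList j i n ++ r) := by
        rw [altList, List.cons_append, wordProd_cons, ← List.append_assoc, ← ht, ← h2,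
          D.inv_mul_cancel_left]
      refine ⟨t ++ l₂, hr.of_length_le e ?_, e.trans h⟩
      simp only [ht', List.length_append, length_altList, List.length_cons]
      lia
    rcases List.append_eq_append_iff.1 h1 with ⟨t, ht, ht'⟩ | ⟨t, ht, ht'⟩
    · exact outside ht ht'
    · rcases t with _ | ⟨y, t⟩
      · exact outside (t := []) (by simpa using ht.symm) (by simpa using ht'.symm)
      -- The deleted letter lies inside the alternating prefix. Cancelling `r` writes the reduced
      -- alternating word of length n + 1 as a product of fewer letters.
      · exfalso
        have hred := D.isReduced_altList hm hsymm hij hn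
        simp only [List.cons_append, List.cons.injEq] at ht'
        obtain ⟨rfl, rfl⟩ := ht'
        have := hred (l₁ ++ t) (by
          rw [altList, wordProd_cons]
          have h3 := h2
          rw [wordProd_append, ← mul_assoc, ← List.append_assoc, wordProd_append] at h3
          exact (mul_right_cancel h3).symm)
        have h4 := congrArg List.length ht
        simp at this h4
        lia

/-- **Matsumoto's theorem**: if the elements `T i` of a monoid satisfy the braid relations, the
products of the `T i` along two reduced words for the same group element coincide. -/
theorem matsumoto {m : ι → ι → ℕ∞}
    (hm : ∀ i j, i ≠ j → ∀ n : ℕ, ((n + 1 : ℕ) : ℕ∞) ≤ m i j → ¬ N (wordProd s (altList j i n)) i)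
    (hsymm : ∀ i j, m i j = m j i)
    (hs : ∀ i j, i ≠ j → ∀ n : ℕ, m i j = n →
      wordProd s (altList i j n) = wordProd s (altList j i n))
    {T : ι → M}
    (hT : ∀ i j, i ≠ j → ∀ n : ℕ, m i j = n →
      wordProd T (altList i j n) = wordProd T (altList j i n))
    (hpos : ∀ i j, m i j ≠ 0) {l l' : List ι} (hl : IsReduced s l) (hl' : IsReduced s l')
    (h : wordProd s l = wordProd s l') : wordProd T l = wordProd T l' := by
  induction hn : l.length generalizing l l' with
  | zero =>
    have := hl.length_eq hl' h
    rw [List.eq_nil_of_length_eq_zero hn, List.eq_nil_of_length_eq_zero (this.symm.trans hn)]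
  | succ n ih =>
    have cons_case {i : ι} {p q : List ι} (hp : IsReduced s (i :: p)) (hq : IsReduced s (i :: q))
        (hpn : (i :: p).length = n + 1) (e : wordProd s (i :: p) = wordProd s (i :: q)) :
        wordProd T (i :: p) = wordProd T (i :: q) := by
      rw [wordProd_cons, wordProd_cons, ih hp.of_cons hq.of_cons ?_ (by simpa using hpn)]
      simpa using e
    have hlen := hl.length_eq hl' h
    rcases l with _ | ⟨i, p⟩
    · simp at hn
    rcases l' with _ | ⟨j, q⟩
    · simp at hlen
    by_cases hij : i = j
    · subst hij
      exact cons_case hl hl' hn h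
    have hi := D.descent_of_isReduced hl
    have hj := D.descent_of_isReduced hl'
    rw [← h] at hj
    rcases hmij : m i j with _ | k
    -- If m i j is infinite, an alternating prefix of length n + 2 would not fit into a reduced word
    -- of length n + 1.
    · obtain ⟨r, hr, e⟩ := D.exists_altList_append (n := n + 2) hm hsymm hl hij hi hj
        (by rw [show m i j = ⊤ from hmij]; exact le_top)
      have := hr.length_eq hl e
      simp at this hn
      lia
    · have hmij : m i j = (k : ℕ) := hmij
      obtain ⟨k, rfl⟩ : ∃ k', k = k' + 1 := Nat.exists_eq_succ_of_ne_zero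
        (by rintro rfl; exact hpos i j hmij)
      obtain ⟨r, hr, e⟩ := D.exists_altList_append hm hsymm hl hij hi hj hmij.ge
      have e' : wordProd s (altList j i (k + 1) ++ r) = wordProd s (altList i j (k + 1) ++ r) := by
        rw [wordProd_append, wordProd_append, hs i j hij _ hmij]
      have hr' : IsReduced s (altList j i (k + 1) ++ r) := hr.of_length_le e' (by simp)
      -- Both words are joined through the two alternating prefixes: equal first letters are handled
      -- by induction, and the prefixes are exchanged by the braid relation.
      have e1 : wordProd T (i :: p) = wordProd T (altList i j (k + 1) ++ r) :=
        cons_case hl hr hn e.symm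
      have e2 : wordProd T (altList j i (k + 1) ++ r) = wordProd T (j :: q) :=
        cons_case hr' hl' (by
          have := hr'.length_eq hl' (e'.trans (e.trans h))
          rw [← hn, hlen, ← this]; rfl) (e'.trans (e.trans h))
      rw [e1, ← e2, wordProd_append, wordProd_append, hT i j hij _ hmij]

end DescentSystem

end ReducedWord

noncomputable section

/-! ### Reflections acting on affine linear functions -/

namespace AffineRoot

variable {V P : Type*} [NormedAddCommGroup V] [InnerProductSpace ℝ V] [FiniteDimensional ℝ V]
  [MetricSpace P] [NormedAddTorsor V P]

theorem grad_add (a b : P →ᵃ[ℝ] ℝ) : grad (a + b) = grad a + grad b := by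
  simp [grad]

theorem grad_smul (r : ℝ) (a : P →ᵃ[ℝ] ℝ) : grad (r • a) = r • grad a := by
  simp [grad]

theorem pairing_add (a b c : P →ᵃ[ℝ] ℝ) : pairing a (b + c) = pairing a b + pairing a c := by
  simp [pairing, grad_add, inner_add_right]

theorem pairing_smul (a b : P →ᵃ[ℝ] ℝ) (r : ℝ) : pairing a (r • b) = r * pairing a b := by
  simp [pairing, grad_smul, inner_smul_right]

theorem pairing_eq (a b : P →ᵃ[ℝ] ℝ) :
    pairing a b = 2 / ‖grad a‖ ^ 2 * inner ℝ (grad a) (grad b) := by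
  simp [pairing, covector, inner_smul_left]

theorem pairing_self {a : P →ᵃ[ℝ] ℝ} (ha : grad a ≠ 0) : pairing a a = 2 := by
  rw [pairing_eq, real_inner_self_eq_norm_sq]
  field_simp [norm_ne_zero_iff.2 ha]

theorem pairing_eq_zero_comm {a b : P →ᵃ[ℝ] ℝ} (ha : grad a ≠ 0) (hb : grad b ≠ 0) :
    pairing a b = 0 ↔ pairing b a = 0 := by
  rw [pairing_eq, pairing_eq, real_inner_comm]
  simp [ha, hb]

theorem pairing_smul_left {r : ℝ} (hr : r ≠ 0) (a b : P →ᵃ[ℝ] ℝ) :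
    pairing (r • a) b = r⁻¹ * pairing a b := by
  rw [pairing_eq, pairing_eq, grad_smul, norm_smul, inner_smul_left, mul_pow, Real.norm_eq_abs,
    sq_abs]
  simp only [conj_trivial]
  field_simp

theorem act_add (g : P ≃ᵃⁱ[ℝ] P) (a b : P →ᵃ[ℝ] ℝ) : act g (a + b) = act g a + act g b := rfl

theorem act_smul (g : P ≃ᵃⁱ[ℝ] P) (r : ℝ) (a : P →ᵃ[ℝ] ℝ) : act g (r • a) = r • act g a := rfl

theorem act_neg (g : P ≃ᵃⁱ[ℝ] P) (a : P →ᵃ[ℝ] ℝ) : act g (-a) = -act g a := rfl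

theorem act_act_inv (g : P ≃ᵃⁱ[ℝ] P) (a : P →ᵃ[ℝ] ℝ) : act g (act g⁻¹ a) = a := by
  rw [← act_mul, mul_inv_cancel, act_one]

theorem apply_reflection (a b : P →ᵃ[ℝ] ℝ) (e : P) :
    b (reflection a e) = b e - pairing a b * a e := by
  rw [reflection_apply, apply_vadd, inner_neg_right, inner_smul_right, real_inner_comm, pairing]
  ring

theorem reflection_mul_self {a : P →ᵃ[ℝ] ℝ} (ha : grad a ≠ 0) :
    reflection a * reflection a = 1 := by
  ext e
  change reflection a (reflection a e) = e
  rw [reflection_apply a (reflection a e), apply_reflection, pairing_self ha, reflection_apply,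
    vadd_vadd]
  convert zero_vadd V e
  module

theorem reflection_inv {a : P →ᵃ[ℝ] ℝ} (ha : grad a ≠ 0) : (reflection a)⁻¹ = reflection a :=
  inv_eq_of_mul_eq_one_left (reflection_mul_self ha)

theorem act_reflection {a : P →ᵃ[ℝ] ℝ} (ha : grad a ≠ 0) (b : P →ᵃ[ℝ] ℝ) :
    act (reflection a) b = b - pairing a b • a := by
  ext e
  rw [act_apply, reflection_inv ha, apply_reflection]
  simp

theorem reflection_smul {r : ℝ} (hr : r ≠ 0) (a : P →ᵃ[ℝ] ℝ) :
    reflection (r • a) = reflection a := by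
  ext e
  rw [reflection_apply, reflection_apply, covector, covector, grad_smul, norm_smul, mul_pow,
    Real.norm_eq_abs, sq_abs, smul_smul, smul_smul, smul_smul]
  congr 3
  simp
  field_simp

/-- The affine linear function with gradient `v` vanishing at `p`. -/
def linearFunction (p : P) (v : V) : P →ᵃ[ℝ] ℝ :=
  ((innerₛₗ ℝ v).toAffineMap).comp (AffineEquiv.vaddConst ℝ p).symm.toAffineMap

theorem linearFunction_apply (p : P) (v : V) (e : P) :
    linearFunction p v e = inner ℝ v (e -ᵥ p) := rfl

theorem eq_linearFunction_add_const (p : P) (a : P →ᵃ[ℝ] ℝ) :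
    a = linearFunction p (grad a) + a p • AffineMap.const ℝ P 1 := by
  ext e
  have := apply_vadd a (e -ᵥ p) p
  rw [vsub_vadd] at this
  simp [linearFunction_apply, this, add_comm]

/-- A linear functional on the affine linear functions that maps `1` to `1` is the evaluation
at a point. -/
theorem exists_eq_apply (φ : (P →ᵃ[ℝ] ℝ) →ₗ[ℝ] ℝ) (hφ : φ (AffineMap.const ℝ P 1) = 1) :
    ∃ e : P, ∀ a, φ a = a e := by
  let p : P := Classical.arbitrary P
  let ψ : V →ₗ[ℝ] ℝ :=
    { toFun := fun v => φ (linearFunction p v)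
      map_add' := fun v w => by
        rw [← map_add]; congr 1; ext e; simp [linearFunction_apply, inner_add_left]
      map_smul' := fun r v => by
        rw [RingHom.id_apply, ← map_smul]; congr 1; ext e
        simp [linearFunction_apply, inner_smul_left] }
  let v : V := (InnerProductSpace.toDual ℝ V).symm (LinearMap.toContinuousLinearMap ψ)
  have hv (w : V) : inner ℝ v w = ψ w := by simp [v]
  refine ⟨v +ᵥ p, fun a => ?_⟩
  rw [apply_vadd, real_inner_comm, hv]
  conv_lhs => rw [eq_linearFunction_add_const p a]
  rw [map_add, map_smul, hφ]
  simp [ψ, add_comm]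

theorem eq_of_act_eq {g h : P ≃ᵃⁱ[ℝ] P} (H : ∀ a : P →ᵃ[ℝ] ℝ, act g a = act h a) : g = h := by
  rw [← inv_inj]
  ext e
  -- The test function vanishes at h⁻¹ e, and its value at g⁻¹ e is the squared distance between the
  -- two points.
  have := congrArg (fun f : P →ᵃ[ℝ] ℝ => f e) (H (linearFunction (h⁻¹ e) (g⁻¹ e -ᵥ h⁻¹ e)))
  simp only [act_apply, linearFunction_apply, vsub_self, inner_zero_right, inner_self_eq_zero,
    vsub_eq_zero_iff_eq] at this
  exact this

theorem grad_act (g : P ≃ᵃⁱ[ℝ] P) (a : P →ᵃ[ℝ] ℝ) :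
    grad (act g a) = g.linearIsometryEquiv (grad a) := by
  refine ext_inner_right ℝ fun v => ?_
  rw [inner_grad, ← g.linearIsometryEquiv.symm.inner_map_map,
    LinearIsometryEquiv.symm_apply_apply, inner_grad]
  rfl

theorem pairing_act (g : P ≃ᵃⁱ[ℝ] P) (a b : P →ᵃ[ℝ] ℝ) :
    pairing (act g a) (act g b) = pairing a b := by
  rw [pairing_eq, pairing_eq, grad_act, grad_act, LinearIsometryEquiv.norm_map,
    LinearIsometryEquiv.inner_map_map]

theorem mul_reflection {g : P ≃ᵃⁱ[ℝ] P} {a : P →ᵃ[ℝ] ℝ} (ha : grad a ≠ 0) :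
    g * reflection a = reflection (act g a) * g := by
  have ha' : grad (act g a) ≠ 0 := by rw [grad_act]; simpa using ha
  refine eq_of_act_eq fun b => ?_
  rw [act_mul, act_mul, act_reflection ha, act_reflection ha', pairing_act, sub_eq_add_neg,
    act_add, act_neg, act_smul, ← sub_eq_add_neg]

end AffineRoot

/-! ### Chambers and the sign of affine roots. -/

namespace AffineRootSystem

open AffineRoot

variable {V P : Type*} [NormedAddCommGroup V] [InnerProductSpace ℝ V] [FiniteDimensional ℝ V]
  [MetricSpace P] [NormedAddTorsor V P] {R : AffineRootSystem V P}

theorem neg_mem {a : P →ᵃ[ℝ] ℝ} (ha : a ∈ R.roots) : -a ∈ R.roots := by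
  have := R.act_mem _ (R.s ⟨a, ha⟩).2 a ha
  have h0 := R.nonisotropic a ha
  rw [s, act_reflection h0, pairing_self h0] at this
  convert this using 1
  module

theorem s_mul_self (a : R.roots) : R.s a * R.s a = 1 :=
  Subtype.ext (reflection_mul_self (R.nonisotropic a a.2))

theorem act_s (a : R.roots) (b : P →ᵃ[ℝ] ℝ) :
    act (R.s a : P ≃ᵃⁱ[ℝ] P) b = b - pairing (a : P →ᵃ[ℝ] ℝ) b • (a : P →ᵃ[ℝ] ℝ) :=
  act_reflection (R.nonisotropic a a.2) b

/-- The translation by v and its inverse shift a by the constant (Da, v), with either sign. -/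
theorem add_const_mem {a : P →ᵃ[ℝ] ℝ} (ha : a ∈ R.roots) {v : V}
    (hv : v ∈ translations (reflectionGroup R.roots)) :
    a - inner ℝ (grad a) v • AffineMap.const ℝ P 1 ∈ R.roots
      ∧ a + inner ℝ (grad a) v • AffineMap.const ℝ P 1 ∈ R.roots := by
  have h1 := R.act_mem _ hv a ha
  have h2 := R.act_mem _ (inv_mem hv) a ha
  constructor
  · convert h1 using 1
    ext e
    have h : (AffineIsometryEquiv.constVAdd ℝ P v)⁻¹ e = -v +ᵥ e := rfl
    rw [act_apply, h, apply_vadd]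
    simp [sub_eq_add_neg]
  · convert h2 using 1
    ext e
    have h : (AffineIsometryEquiv.constVAdd ℝ P v) e = v +ᵥ e := rfl
    rw [act_apply, inv_inv, h, apply_vadd]
    simp

theorem add_nsmul_const_mem {a : P →ᵃ[ℝ] ℝ} (ha : a ∈ R.roots) {v : V}
    (hv : v ∈ translations (reflectionGroup R.roots)) (n : ℕ) :
    a - (n * inner ℝ (grad a) v) • AffineMap.const ℝ P 1 ∈ R.roots
      ∧ a + (n * inner ℝ (grad a) v) • AffineMap.const ℝ P 1 ∈ R.roots := by
  have hg : ∀ (a : P →ᵃ[ℝ] ℝ) (r : ℝ), grad (a + r • AffineMap.const ℝ P 1) = grad a := by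
    intro a r
    refine ext_inner_right ℝ fun v => ?_
    rw [inner_grad, inner_grad]
    simp
  induction n with
  | zero => simpa using ha
  | succ n ih =>
    have h1 := (add_const_mem ih.1 hv).1
    have h2 := (add_const_mem ih.2 hv).2
    rw [hg] at h2
    rw [sub_eq_add_neg a, ← neg_smul, hg] at h1
    constructor
    · convert h1 using 1
      push_cast
      module
    · convert h2 using 1
      push_cast
      module

namespace OrderedBasis

variable {n : ℕ} (Δ : R.OrderedBasis n)

/-- The chamber `{e | a_i(e) > 0 for all i}`. -/
def chamber : Set P := {e | ∀ i, 0 < Δ.root i e}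

theorem chamber_nonempty : Δ.chamber.Nonempty := by
  obtain ⟨e, he, h⟩ := Δ.isChamber
  exact ⟨e, by rw [chamber, h]; exact mem_connectedComponentIn he⟩

theorem isPreconnected_chamber : IsPreconnected Δ.chamber := by
  obtain ⟨e, he, h⟩ := Δ.isChamber
  rw [chamber, h]
  exact isPreconnected_connectedComponentIn

theorem chamber_subset : Δ.chamber ⊆ R.regular := by
  obtain ⟨e, he, h⟩ := Δ.isChamber
  rw [chamber, h]
  exact connectedComponentIn_subset _ _

theorem pos_of_pos {a : P →ᵃ[ℝ] ℝ} (ha : a ∈ R.roots) {e e' : P} (he : e ∈ Δ.chamber)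
    (he' : e' ∈ Δ.chamber) (h : 0 < a e) : 0 < a e' := by
  by_contra! h'
  obtain ⟨x, hx, hx0⟩ := Δ.isPreconnected_chamber.intermediate_value he' he
    a.continuous_of_finiteDimensional.continuousOn ⟨h', h.le⟩
  exact Δ.chamber_subset hx a ha hx0

theorem neg_of_neg {a : P →ᵃ[ℝ] ℝ} (ha : a ∈ R.roots) {e e' : P} (he : e ∈ Δ.chamber)
    (he' : e' ∈ Δ.chamber) (h : a e < 0) : a e' < 0 := by
  have := Δ.pos_of_pos (neg_mem ha) he he' (by simpa using h)
  simpa using this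

/-- Some translation in W is not parallel to the hyperplane of a_i, so a_i - M is a root for
arbitrarily large M. Choosing it negative at one point of the chamber makes it negative on the whole
chamber. -/
theorem exists_bound (i : Fin (n + 1)) : ∃ M : ℝ, ∀ e ∈ Δ.chamber, Δ.root i e < M := by
  have hi := R.nonisotropic _ (Δ.mem i)
  obtain ⟨v, hv, hv0⟩ : ∃ v ∈ translations (reflectionGroup R.roots),
      inner ℝ (grad (Δ.root i)) v ≠ 0 := by
    by_contra! H
    have hle : Submodule.span ℝ (translations (reflectionGroup R.roots)) ≤
        LinearMap.ker (innerₛₗ ℝ (grad (Δ.root i))) :=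
      Submodule.span_le.2 fun v hv => by simpa using H v hv
    rw [R.span_translations] at hle
    have := hle (Submodule.mem_top (x := grad (Δ.root i)))
    exact hi (by simpa using this)
  obtain ⟨e₀, he₀⟩ := Δ.chamber_nonempty
  set r := inner ℝ (grad (Δ.root i)) v
  obtain ⟨m, hm⟩ := exists_nat_gt (Δ.root i e₀ / |r|)
  rw [div_lt_iff₀ (abs_pos.2 hv0)] at hm
  have key (b : P →ᵃ[ℝ] ℝ) (hb : b ∈ R.roots) (h : b = Δ.root i - (m * |r|) • AffineMap.const ℝ P 1) :
      ∃ M : ℝ, ∀ e ∈ Δ.chamber, Δ.root i e < M := by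
    refine ⟨m * |r|, fun e he => ?_⟩
    have := Δ.neg_of_neg hb he₀ he (by rw [h]; simpa using hm)
    rw [h] at this
    simpa using this
  rcases abs_choice r with h | h
  · exact key _ (add_nsmul_const_mem (Δ.mem i) hv m).1 (by rw [h])
  · refine key _ (add_nsmul_const_mem (Δ.mem i) hv m).2 ?_
    rw [h]
    module

/-- The basis of the space of affine linear functions. -/
def basis : Module.Basis (Fin (n + 1)) ℝ (P →ᵃ[ℝ] ℝ) :=
  Module.Basis.mk Δ.linearIndependent Δ.span_eq_top.ge

@[simp]
theorem basis_apply (i : Fin (n + 1)) : Δ.basis i = Δ.root i := by simp [basis]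

theorem sum_coord_mul (a : P →ᵃ[ℝ] ℝ) (φ : (P →ᵃ[ℝ] ℝ) →ₗ[ℝ] ℝ) :
    φ a = ∑ i, Δ.basis.repr a i * φ (Δ.root i) := by
  conv_lhs => rw [← Δ.basis.sum_repr a]
  simp

theorem coord_root (i j : Fin (n + 1)) :
    Δ.basis.repr (Δ.root j) i = if i = j then 1 else 0 := by
  rw [← basis_apply, Module.Basis.repr_self, Finsupp.single_apply]
  simp [eq_comm]

theorem coord_root_self (i : Fin (n + 1)) : Δ.basis.repr (Δ.root i) i = 1 := by
  simp [coord_root]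

/-- If the i-th coordinate of 1 were not positive, one could move inside the chamber so that a_i
grows without bound, against `exists_bound`. -/
theorem coord_one_pos (i : Fin (n + 1)) :
    0 < Δ.basis.repr (AffineMap.const ℝ P 1) i := by
  by_contra! hi
  set c := Δ.basis.repr (AffineMap.const ℝ P (1 : ℝ)) with hc
  obtain ⟨e₀, he₀⟩ := Δ.chamber_nonempty
  let ev : (P →ᵃ[ℝ] ℝ) →ₗ[ℝ] ℝ :=
    { toFun := fun a => a e₀, map_add' := fun _ _ => rfl, map_smul' := fun _ _ => rfl }
  have hev (a) : ev a = a e₀ := rfl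
  have h1 := Δ.sum_coord_mul (AffineMap.const ℝ P 1) ev
  obtain ⟨j, hj⟩ : ∃ j, 0 < c j := by
    by_contra! H
    have : ∑ i, c i * ev (Δ.root i) ≤ 0 :=
      Finset.sum_nonpos fun j _ => mul_nonpos_of_nonpos_of_nonneg (H j) (he₀ j).le
    rw [← h1, hev] at this
    simp at this
    linarith
  have hij : i ≠ j := by rintro rfl; exact absurd hj (not_lt.2 hi)
  obtain ⟨M, hM⟩ := Δ.exists_bound i
  let t := max 0 M
  -- This raises a_i by t and a_j by t(-c_i/c_j) ≥ 0 and fixes the other simple roots. The two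
  -- changes cancel on the constant 1, so the functional is evaluation at a point.
  let φ : (P →ᵃ[ℝ] ℝ) →ₗ[ℝ] ℝ := ev + t • (Δ.basis.coord i + (-c i / c j) • Δ.basis.coord j)
  have hφ (a) : φ a = a e₀ + t * (Δ.basis.repr a i + -c i / c j * Δ.basis.repr a j) := rfl
  obtain ⟨e, he⟩ := exists_eq_apply φ (by
    rw [hφ, ← hc, div_mul_cancel₀ _ hj.ne']
    simp)
  have ht : 0 ≤ t := le_max_left _ _
  have hcc : 0 ≤ -c i / c j := div_nonneg (by linarith) hj.le
  have heC : e ∈ Δ.chamber := by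
    intro l
    rw [← he, hφ, coord_root, coord_root]
    have := he₀ l
    split_ifs <;> positivity
  have := hM e heC
  rw [← he, hφ, coord_root_self, coord_root, if_neg hij.symm] at this
  have h2 : M ≤ t := le_max_right _ _
  have h3 := he₀ i
  linarith

/-- The functional `coord i` divided by its value on 1 is evaluation at the vertex of the chamber
where all a_j with j ≠ i vanish. A negative coordinate would make a negative at that vertex, hence
at chamber points near it. -/
theorem coord_nonneg {a : P →ᵃ[ℝ] ℝ} (ha : ∀ e ∈ Δ.chamber, 0 < a e) (i : Fin (n + 1)) :
    0 ≤ Δ.basis.repr a i := by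
  by_contra! hi
  have hc := Δ.coord_one_pos i
  set c := Δ.basis.repr (AffineMap.const ℝ P (1 : ℝ)) i
  obtain ⟨e₀, he₀⟩ := Δ.chamber_nonempty
  have h0 := ha e₀ he₀
  let ev : (P →ᵃ[ℝ] ℝ) →ₗ[ℝ] ℝ :=
    { toFun := fun a => a e₀, map_add' := fun _ _ => rfl, map_smul' := fun _ _ => rfl }
  set p := -(Δ.basis.repr a i / c) with hp
  have hp0 : 0 < p := by rw [hp, neg_pos]; exact div_neg_of_neg_of_pos hi hc
  -- The value of a at the point (1 - ε)·vertex + ε·e₀ is ε(p + a e₀) - p, which this choice makes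
  -- equal to -p/2.
  let ε := p / (2 * (p + a e₀))
  have hε : 0 < ε := by positivity
  have hε1 : ε < 1 := by
    rw [div_lt_one (by positivity)]; linarith
  let φ : (P →ᵃ[ℝ] ℝ) →ₗ[ℝ] ℝ := ((1 - ε) / c) • Δ.basis.coord i + ε • ev
  have hφ (a) : φ a = (1 - ε) / c * Δ.basis.repr a i + ε * a e₀ := rfl
  obtain ⟨e, he⟩ := exists_eq_apply φ (by
    rw [hφ, div_mul_cancel₀ _ hc.ne']
    simp)
  have heC : e ∈ Δ.chamber := by
    intro l
    rw [← he, hφ, coord_root]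
    have := he₀ l
    have : 0 < 1 - ε := by linarith
    split_ifs <;> positivity
  have := ha e heC
  rw [← he, hφ] at this
  have h4 : (1 - ε) / c * Δ.basis.repr a i = -(1 - ε) * p := by rw [hp]; field_simp
  have h5 : ε * (p + a e₀) = p / 2 := by simp only [ε]; field_simp
  rw [h4] at this
  nlinarith

/-- Every affine root is either positive or negative. -/
theorem coord_nonneg_or_nonpos {a : P →ᵃ[ℝ] ℝ} (ha : a ∈ R.roots) :
    (∀ i, 0 ≤ Δ.basis.repr a i) ∨ ∀ i, Δ.basis.repr a i ≤ 0 := by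
  obtain ⟨e, he⟩ := Δ.chamber_nonempty
  rcases lt_or_gt_of_ne (Δ.chamber_subset he a ha) with h | h
  · right
    intro i
    have := Δ.coord_nonneg (a := -a) (fun e' he' => Δ.pos_of_pos (neg_mem ha) he he'
      (by simpa using h)) i
    simpa using this
  · exact Or.inl (Δ.coord_nonneg fun e' he' => Δ.pos_of_pos ha he he' h)

theorem not_coord_nonneg_and_nonpos {a : P →ᵃ[ℝ] ℝ} (ha : a ∈ R.roots)
    (h1 : ∀ i, 0 ≤ Δ.basis.repr a i) (h2 : ∀ i, Δ.basis.repr a i ≤ 0) : False := by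
  have : a = 0 := Δ.basis.repr.injective (by
    ext i
    rw [map_zero]
    exact le_antisymm (h2 i) (h1 i))
  refine R.nonisotropic a ha ?_
  rw [this]
  simpa using grad_smul (P := P) 0 0

end OrderedBasis

end AffineRootSystem

end

noncomputable section

/-! ### The reflections in the simple affine roots -/

namespace AffineRootSystem

open AffineRoot ReducedWord

variable {V P : Type*} [NormedAddCommGroup V] [InnerProductSpace ℝ V] [FiniteDimensional ℝ V]
  [MetricSpace P] [NormedAddTorsor V P] {R : AffineRootSystem V P}

namespace OrderedBasis

variable {n : ℕ} (Δ : R.OrderedBasis n)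

/-- The reflection in the simple affine root `a_i`. -/
def simpleReflection (i : Fin (n + 1)) : R.weylGroup := R.s (Δ.simpleRoot i)

theorem simpleReflection_mul_self (i : Fin (n + 1)) :
    Δ.simpleReflection i * Δ.simpleReflection i = 1 := s_mul_self _

theorem simpleReflection_inv (i : Fin (n + 1)) :
    (Δ.simpleReflection i)⁻¹ = Δ.simpleReflection i :=
  inv_eq_of_mul_eq_one_left (Δ.simpleReflection_mul_self i)

theorem act_simpleReflection (i : Fin (n + 1)) (b : P →ᵃ[ℝ] ℝ) :
    act (Δ.simpleReflection i : P ≃ᵃⁱ[ℝ] P) b = b - pairing (Δ.root i) b • Δ.root i :=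
  act_s _ b

theorem pairing_root (i j : Fin (n + 1)) : pairing (Δ.root i) (Δ.root j) = Δ.cartanMatrix i j :=
  (R.cartanInt_spec (Δ.simpleRoot i) (Δ.simpleRoot j)).symm

theorem cartanMatrix_self (i : Fin (n + 1)) : Δ.cartanMatrix i i = 2 := by
  have := Δ.pairing_root i i
  rw [pairing_self (R.nonisotropic _ (Δ.mem i))] at this
  exact_mod_cast this.symm

theorem cartanMatrix_eq_zero_comm (i j : Fin (n + 1)) :
    Δ.cartanMatrix i j = 0 ↔ Δ.cartanMatrix j i = 0 := by
  have := pairing_eq_zero_comm (R.nonisotropic _ (Δ.mem i)) (R.nonisotropic _ (Δ.mem j))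
  rw [pairing_root, pairing_root] at this
  exact_mod_cast this

theorem act_mem' (w : R.weylGroup) (i : Fin (n + 1)) :
    act (w : P ≃ᵃⁱ[ℝ] P) (Δ.root i) ∈ R.roots := R.act_mem w w.2 _ (Δ.mem i)

/-- The root s_i a_j has j-th coordinate 1, so it is positive, and its i-th coordinate is -a_ij. -/
theorem cartanMatrix_nonpos {i j : Fin (n + 1)} (hij : i ≠ j) : Δ.cartanMatrix i j ≤ 0 := by
  have h := Δ.act_simpleReflection i (Δ.root j)
  have hm := Δ.act_mem' (Δ.simpleReflection i) j
  rw [pairing_root] at h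
  rw [h] at hm
  rcases Δ.coord_nonneg_or_nonpos hm with H | H
  · have := H i
    simp [coord_root, hij] at this
    exact_mod_cast this
  · have := H j
    simp [coord_root, hij.symm] at this
    linarith

/-- The affine root `w⁻¹ a_j` is negative. -/
def IsDescent (w : R.weylGroup) (j : Fin (n + 1)) : Prop :=
  ∀ i, Δ.basis.repr (act ((w⁻¹ : R.weylGroup) : P ≃ᵃⁱ[ℝ] P) (Δ.root j)) i ≤ 0

theorem coord_nonneg_of_not_isDescent {w : R.weylGroup} {j : Fin (n + 1)}
    (h : ¬ Δ.IsDescent w j) (i : Fin (n + 1)) :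
    0 ≤ Δ.basis.repr (act ((w⁻¹ : R.weylGroup) : P ≃ᵃⁱ[ℝ] P) (Δ.root j)) i :=
  (Δ.coord_nonneg_or_nonpos (Δ.act_mem' w⁻¹ j)).resolve_right h i

theorem descentSystem : DescentSystem Δ.simpleReflection Δ.IsDescent where
  mul_self := Δ.simpleReflection_mul_self
  not_one j h := by
    have := h j
    rw [inv_one, Subgroup.coe_one, act_one, coord_root_self] at this
    linarith
  mul_left w j := by
    have h : act ((Δ.simpleReflection j * w)⁻¹ : R.weylGroup) (Δ.root j)
        = -act ((w⁻¹ : R.weylGroup) : P ≃ᵃⁱ[ℝ] P) (Δ.root j) := by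
      rw [mul_inv_rev, simpleReflection_inv, Subgroup.coe_mul, act_mul, act_simpleReflection,
        pairing_self (R.nonisotropic _ (Δ.mem j)), ← act_neg]
      congr 1
      module
    constructor
    · intro h1 h2
      refine Δ.not_coord_nonneg_and_nonpos (Δ.act_mem' w⁻¹ j) (fun i => ?_) h2
      have := h1 i
      rw [h] at this
      simpa using this
    · intro h1 i
      rw [h]
      simpa using Δ.coord_nonneg_of_not_isDescent h1 i
  fold w i j h1 h2 := by
    -- The reflection s_i changes only the i-th coordinate. As it turns the positive root w⁻¹ a_j
    -- into a negative one, w⁻¹ a_j is a multiple of a_i and the two reflections are conjugate under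
    -- w.
    set a := act ((w⁻¹ : R.weylGroup) : P ≃ᵃⁱ[ℝ] P) (Δ.root j) with ha
    have haR : a ∈ R.roots := Δ.act_mem' w⁻¹ j
    have h3 : act ((w * Δ.simpleReflection i)⁻¹ : R.weylGroup) (Δ.root j)
        = a - pairing (Δ.root i) a • Δ.root i := by
      rw [mul_inv_rev, simpleReflection_inv, Subgroup.coe_mul, act_mul, act_simpleReflection]
    have h4 (l : Fin (n + 1)) (hl : l ≠ i) : Δ.basis.repr a l = 0 := by
      refine le_antisymm ?_ (Δ.coord_nonneg_of_not_isDescent h1 l)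
      have := h2 l
      rw [h3] at this
      simpa [coord_root, hl] using this
    have h5 : a = Δ.basis.repr a i • Δ.root i := by
      apply Δ.basis.repr.injective
      ext l
      by_cases hl : l = i
      · subst hl; simp [coord_root]
      · simp [h4 l hl, coord_root, hl]
    set r := Δ.basis.repr a i
    have hr : r ≠ 0 := by
      intro h0
      rw [h0] at h5
      refine R.nonisotropic a haR ?_
      rw [h5, grad_smul, zero_smul]
    have h6 : act (w : P ≃ᵃⁱ[ℝ] P) a = Δ.root j := act_act_inv _ _
    apply Subtype.ext
    change (w : P ≃ᵃⁱ[ℝ] P) * reflection (Δ.root i) = reflection (Δ.root j) * w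
    rw [← reflection_smul hr, ← h5, mul_reflection (R.nonisotropic a haR), h6]

/-! ### Rank two computations -/

theorem cartan_cases {i j : Fin (n + 1)} (hij : i ≠ j) :
    (Δ.cartanMatrix i j = 0 ∧ Δ.cartanMatrix j i = 0 ∧
      CartanHecke.braidExponent Δ.cartanMatrix i j = 2) ∨
    (Δ.cartanMatrix i j = -1 ∧ Δ.cartanMatrix j i = -1 ∧
      CartanHecke.braidExponent Δ.cartanMatrix i j = 3) ∨
    (Δ.cartanMatrix i j = -1 ∧ Δ.cartanMatrix j i = -2 ∧
      CartanHecke.braidExponent Δ.cartanMatrix i j = 4) ∨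
    (Δ.cartanMatrix i j = -2 ∧ Δ.cartanMatrix j i = -1 ∧
      CartanHecke.braidExponent Δ.cartanMatrix i j = 4) ∨
    (Δ.cartanMatrix i j = -1 ∧ Δ.cartanMatrix j i = -3 ∧
      CartanHecke.braidExponent Δ.cartanMatrix i j = 6) ∨
    (Δ.cartanMatrix i j = -3 ∧ Δ.cartanMatrix j i = -1 ∧
      CartanHecke.braidExponent Δ.cartanMatrix i j = 6) ∨
    (4 ≤ Δ.cartanMatrix i j * Δ.cartanMatrix j i ∧
      CartanHecke.braidExponent Δ.cartanMatrix i j = ⊤) := by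
  have h1 := Δ.cartanMatrix_nonpos hij
  have h2 := Δ.cartanMatrix_nonpos hij.symm
  have h3 := Δ.cartanMatrix_eq_zero_comm i j
  simp only [CartanHecke.braidExponent, if_neg hij]
  generalize Δ.cartanMatrix i j = p at *
  generalize Δ.cartanMatrix j i = q at *
  by_cases h4 : 4 ≤ p * q
  · have e (m : ℤ) (hm : m < 4) : p * q ≠ m := by lia
    simp [h4, e 0, e 1, e 2, e 3, -mul_eq_zero]
  · by_cases hp : p = 0
    · subst hp; simp [h3.1 rfl]
    · have hq : q ≠ 0 := fun h => hp (h3.2 h)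
      have hp' : p ≤ -1 := by lia
      have hq' : q ≤ -1 := by lia
      have : -3 ≤ p := by nlinarith
      have : -3 ≤ q := by nlinarith
      obtain rfl | rfl | rfl : p = -1 ∨ p = -2 ∨ p = -3 := by lia
      all_goals obtain rfl | rfl | rfl : q = -1 ∨ q = -2 ∨ q = -3 := by lia
      all_goals first | (exfalso; revert h4; norm_num; done) | norm_num

theorem braidExponent_comm (i j : Fin (n + 1)) :
    CartanHecke.braidExponent Δ.cartanMatrix i j = CartanHecke.braidExponent Δ.cartanMatrix j i := by
  simp only [CartanHecke.braidExponent, mul_comm (Δ.cartanMatrix i j), eq_comm (a := i)]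

theorem braidExponent_ne_zero (i j : Fin (n + 1)) :
    CartanHecke.braidExponent Δ.cartanMatrix i j ≠ 0 := by
  simp only [CartanHecke.braidExponent]
  split_ifs <;> simp

theorem act_simpleReflection_add (i j : Fin (n + 1)) (b : P →ᵃ[ℝ] ℝ) (x y : ℝ) :
    act (Δ.simpleReflection i : P ≃ᵃⁱ[ℝ] P) (b + x • Δ.root i + y • Δ.root j)
      = b + (-x - pairing (Δ.root i) b - Δ.cartanMatrix i j * y) • Δ.root i + y • Δ.root j := by
  rw [act_simpleReflection, pairing_add, pairing_add, pairing_smul, pairing_smul, pairing_root,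
    pairing_root, cartanMatrix_self]
  push_cast
  module

theorem act_simpleReflection_add' (i j : Fin (n + 1)) (b : P →ᵃ[ℝ] ℝ) (x y : ℝ) :
    act (Δ.simpleReflection j : P ≃ᵃⁱ[ℝ] P) (b + x • Δ.root i + y • Δ.root j)
      = b + x • Δ.root i + (-y - pairing (Δ.root j) b - Δ.cartanMatrix j i * x) • Δ.root j := by
  rw [add_right_comm, act_simpleReflection_add, add_right_comm]

theorem simpleReflection_braid {i j : Fin (n + 1)} (hij : i ≠ j) (m : ℕ)
    (hm : CartanHecke.braidExponent Δ.cartanMatrix i j = m) :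
    wordProd Δ.simpleReflection (altList i j m) = wordProd Δ.simpleReflection (altList j i m) := by
  -- Functions b + x a_i + y a_j with b fixed are preserved by both reflections. The zero multiples
  -- bring b into this form so that the words can be evaluated by rewriting.
  have key (h : ∀ b : P →ᵃ[ℝ] ℝ,
      act ((wordProd Δ.simpleReflection (altList i j m) : R.weylGroup) : P ≃ᵃⁱ[ℝ] P)
        (b + (0 : ℝ) • Δ.root i + (0 : ℝ) • Δ.root j) =
      act ((wordProd Δ.simpleReflection (altList j i m) : R.weylGroup) : P ≃ᵃⁱ[ℝ] P)
        (b + (0 : ℝ) • Δ.root i + (0 : ℝ) • Δ.root j)) :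
      wordProd Δ.simpleReflection (altList i j m) =
        wordProd Δ.simpleReflection (altList j i m) := by
    refine Subtype.ext (eq_of_act_eq fun b => ?_)
    simpa using h b
  refine key fun b => ?_
  rcases Δ.cartan_cases hij with ⟨h1, h2, h3⟩ | ⟨h1, h2, h3⟩ | ⟨h1, h2, h3⟩ | ⟨h1, h2, h3⟩ |
    ⟨h1, h2, h3⟩ | ⟨h1, h2, h3⟩ | ⟨h1, h3⟩ <;> rw [hm] at h3
  case inr.inr.inr.inr.inr.inr => exact absurd h3 (ENat.natCast_ne_top m)
  all_goals
    obtain rfl : m = _ := by exact_mod_cast h3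
    simp only [altList, wordProd_cons, wordProd_nil, mul_one, Subgroup.coe_mul, act_mul,
      act_simpleReflection_add, act_simpleReflection_add', h1, h2]
    push_cast
    module

/-- The coordinates of the result of applying an alternating sequence of two reflections. -/
def altCoord (p q : ℤ) : ℕ → ℤ → ℤ → ℤ × ℤ
  | 0, x, y => (x, y)
  | m + 1, x, y => (altCoord q p m y (-x - p * y)).swap

theorem act_altList (i j : Fin (n + 1)) (m : ℕ) (x y : ℤ) :
    act (((wordProd Δ.simpleReflection (altList i j m))⁻¹ : R.weylGroup) : P ≃ᵃⁱ[ℝ] P)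
        ((x : ℝ) • Δ.root i + (y : ℝ) • Δ.root j)
      = ((altCoord (Δ.cartanMatrix i j) (Δ.cartanMatrix j i) m x y).1 : ℝ) • Δ.root i
        + ((altCoord (Δ.cartanMatrix i j) (Δ.cartanMatrix j i) m x y).2 : ℝ) • Δ.root j := by
  induction m generalizing i j x y with
  | zero => simp [altList, altCoord, act_one]
  | succ m ih =>
    have h := Δ.act_simpleReflection_add i j 0 x y
    rw [zero_add, zero_add, show pairing (Δ.root i) (0 : P →ᵃ[ℝ] ℝ) = 0 by
      simpa using pairing_smul (Δ.root i) (0 : P →ᵃ[ℝ] ℝ) 0, sub_zero] at h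
    rw [altList, wordProd_cons, mul_inv_rev, simpleReflection_inv, Subgroup.coe_mul, act_mul, h,
      add_comm (_ • Δ.root i)]
    have := ih j i y (-x - Δ.cartanMatrix i j * y)
    simp only [Int.cast_sub, Int.cast_neg, Int.cast_mul] at this
    rw [this, altCoord, add_comm (_ • Δ.root j)]
    rfl

/-- The condition -q x ≤ 2 y is an invariant: with p q ≥ 4 it gives 2 x ≤ -p y, so the next pair (y,
-x - p y) satisfies the same conditions with p and q interchanged. -/
theorem altCoord_pos_of_four_le {p q : ℤ} (hp : p ≤ 0) (hq : q ≤ 0) (hpq : 4 ≤ p * q) (m : ℕ)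
    {x y : ℤ} (hx : 0 ≤ x) (hy : 0 < y) (hxy : -q * x ≤ 2 * y) :
    0 < (altCoord p q m x y).1 ∨ 0 < (altCoord p q m x y).2 := by
  induction m generalizing p q x y with
  | zero => exact Or.inr hy
  | succ m ih =>
    have hp0 : p < 0 := lt_of_le_of_ne hp (by rintro rfl; simp at hpq)
    have h1 : 2 * (p * y) ≤ -(4 * x) := by nlinarith
    have := ih hq hp (by rwa [mul_comm]) hy.le (y := -x - p * y) (by nlinarith) (by nlinarith)
    exact this.symm

/-- The coordinates of w⁻¹ a_i are computed from the Cartan integers alone. Finitely many words are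
checked when m_ij is finite, and `altCoord_pos_of_four_le` treats the infinite case. -/
theorem not_isDescent_altList {i j : Fin (n + 1)} (hij : i ≠ j) (m : ℕ)
    (hm : ((m + 1 : ℕ) : ℕ∞) ≤ CartanHecke.braidExponent Δ.cartanMatrix i j) :
    ¬ Δ.IsDescent (wordProd Δ.simpleReflection (altList j i m)) i := by
  have key : 0 < (altCoord (Δ.cartanMatrix j i) (Δ.cartanMatrix i j) m 0 1).1 ∨
      0 < (altCoord (Δ.cartanMatrix j i) (Δ.cartanMatrix i j) m 0 1).2 := by
    rcases Δ.cartan_cases hij with ⟨h1, h2, h3⟩ | ⟨h1, h2, h3⟩ | ⟨h1, h2, h3⟩ | ⟨h1, h2, h3⟩ |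
      ⟨h1, h2, h3⟩ | ⟨h1, h2, h3⟩ | ⟨h1, h3⟩
    case inr.inr.inr.inr.inr.inr =>
      exact altCoord_pos_of_four_le (Δ.cartanMatrix_nonpos hij.symm) (Δ.cartanMatrix_nonpos hij)
        (by rwa [mul_comm]) m le_rfl one_pos (by simp)
    all_goals
      rw [h3] at hm
      replace hm := Nat.cast_le.1 hm
      rw [h1, h2]
      clear h1 h2 h3
      have : m < 6 := by lia
      interval_cases m <;> first | (exfalso; revert hm; decide) | decide
  intro H
  have h := Δ.act_altList j i m 0 1
  rw [Int.cast_zero, zero_smul, zero_add, Int.cast_one, one_smul] at h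
  have Hi := H i
  have Hj := H j
  rw [h] at Hi Hj
  simp [coord_root, hij, hij.symm] at Hi Hj
  lia

end OrderedBasis

end AffineRootSystem

end

noncomputable section

/-! ### Braid relations between Demazure–Lusztig elements -/

namespace RankTwo

variable {𝕜 G K R : Type*} [Field 𝕜] [Group G] [Field K] [Algebra 𝕜 K] [MulSemiringAction G K]
  [SMulCommClass G 𝕜 K] [Ring R] [Algebra 𝕜 R]

/-- The function `k⁻¹ + c(x)`, where `c(x) = (k - k⁻¹ + (v - v⁻¹) x) / (1 - x²)`. -/
def dFunction (k v : 𝕜) (x : K) : K :=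
  (algebraMap 𝕜 K k + (algebraMap 𝕜 K v - (algebraMap 𝕜 K v)⁻¹) * x
    - (algebraMap 𝕜 K k)⁻¹ * x ^ 2) / (1 - x ^ 2)

theorem smul_dFunction (w : G) (k v : 𝕜) (x : K) :
    w • dFunction k v x = dFunction k v (w • x) := by
  simp only [dFunction, smul_div₀', smul_sub, smul_add, smul_mul', smul_pow', smul_inv₀',
    smul_algebraMap, smul_one]

theorem dFunction_inv (k v : 𝕜) {x : K} (hx : x ≠ 0) (hx' : 1 - x ^ 2 ≠ 0) :
    dFunction k v x⁻¹ = algebraMap 𝕜 K (k + k⁻¹) - dFunction k v x := by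
  have : x ^ 2 - 1 ≠ 0 := by rw [← neg_sub]; exact neg_ne_zero.2 hx'
  rw [dFunction, dFunction, map_add, map_inv₀]
  generalize (algebraMap 𝕜 K k)⁻¹ = κ
  generalize algebraMap 𝕜 K v - (algebraMap 𝕜 K v)⁻¹ = U
  field_simp
  ring

/-- For v = k the numerator is (k - k⁻¹ x)(1 + x), which leads to the shape used in the rank two
identities. -/
theorem dFunction_self (k : 𝕜) {x : K} (hx' : 1 - x ^ 2 ≠ 0) :
    dFunction k k x = (algebraMap 𝕜 K k - (algebraMap 𝕜 K k)⁻¹ * x) / (1 - x) := by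
  have h : 1 - x ^ 2 = (1 - x) * (1 + x) := by ring
  rw [h] at hx'
  have h1 := left_ne_zero_of_mul hx'
  rw [dFunction, h, div_eq_div_iff hx' h1]
  ring

/-- The element `(1 + s) (k⁻¹ + c(x)) - k⁻¹`. -/
def lusztig (c : K →ₐ[𝕜] R) (u : G →* R) (s : G) (k v : 𝕜) (x : K) : R :=
  (1 + u s) * c (dFunction k v x) - k⁻¹ • 1

variable {c : K →ₐ[𝕜] R} {u : G →* R} {s t : G} (hc : ∀ g f, u g * c f = c (g • f) * u g)
  {k l v v' : 𝕜} {x y : K}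

include hc

theorem lusztig_eq_add (sx : s • x = x⁻¹) :
    lusztig c u s k v x = c (dFunction k v x - algebraMap 𝕜 K k⁻¹)
      + c (dFunction k v x⁻¹) * u s := by
  rw [lusztig, add_mul, hc, smul_dFunction, sx, one_mul, map_sub, AlgHom.commutes,
    Algebra.algebraMap_eq_smul_one]
  abel

theorem lusztig_eq (sx : s • x = x⁻¹) (hx : x ≠ 0) (hx' : 1 - x ^ 2 ≠ 0) :
    lusztig c u s k v x = k • u s + c ((algebraMap 𝕜 K (k - k⁻¹)
      + algebraMap 𝕜 K (v - v⁻¹) * x) / (1 - x ^ 2)) * (1 - u s) := by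
  have h : (algebraMap 𝕜 K (k - k⁻¹) + algebraMap 𝕜 K (v - v⁻¹) * x) / (1 - x ^ 2)
      = dFunction k v x - algebraMap 𝕜 K k⁻¹ := by
    rw [dFunction, eq_sub_iff_add_eq, div_add' _ _ _ hx']
    congr 1
    simp only [map_sub, map_inv₀]
    ring
  rw [lusztig_eq_add hc sx, h, dFunction_inv k v hx hx']
  simp only [map_sub, map_add, Algebra.algebraMap_eq_smul_one, mul_sub, sub_mul,
    add_mul, mul_one, one_mul, smul_mul_assoc, map_smul, map_one]
  abel

variable (hs : s * s = 1)
include hs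

theorem theta_sq (sx : s • x = x⁻¹) (hx : x ≠ 0) (hx' : 1 - x ^ 2 ≠ 0) :
    (1 + u s) * c (dFunction k v x) * ((1 + u s) * c (dFunction k v x))
      = (k + k⁻¹) • ((1 + u s) * c (dFunction k v x)) :=
  twisted_sq hc hs (by rw [smul_dFunction, sx, dFunction_inv k v hx hx'])

theorem lusztig_quadratic (sx : s • x = x⁻¹) (hx : x ≠ 0) (hx' : 1 - x ^ 2 ≠ 0) :
    (lusztig c u s k v x - algebraMap 𝕜 R k) * (lusztig c u s k v x + algebraMap 𝕜 R k⁻¹) = 0 := by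
  rw [lusztig, Algebra.algebraMap_eq_smul_one, Algebra.algebraMap_eq_smul_one,
    sub_add_cancel, sub_sub, ← add_smul, sub_mul, theta_sq hc hs sx hx hx', smul_mul_assoc, one_mul,
    add_comm k⁻¹, sub_self]

variable (ht : t * t = 1)

omit hs in
theorem lusztig_comm (hst : s * t = t * s) (sy : s • y = y) (tx : t • x = x) :
    lusztig c u s k v x * lusztig c u t l v' y = lusztig c u t l v' y * lusztig c u s k v x := by
  have key : (1 + u s) * c (dFunction k v x) * ((1 + u t) * c (dFunction l v' y))
      = (1 + u t) * c (dFunction l v' y) * ((1 + u s) * c (dFunction k v x)) :=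
    kl_two hc hst (by rw [smul_dFunction, tx]) (by rw [smul_dFunction, sy])
  simp only [lusztig, mul_sub, sub_mul, key, mul_smul_comm, smul_mul_assoc, mul_one, one_mul, smul_sub]
  rw [smul_comm]
  abel

include ht

theorem lusztig_braid_three (hk : k ≠ 0) (hst : s * (t * s) = t * (s * t))
    (sx : s • x = x⁻¹) (sy : s • y = x * y) (tx : t • x = y * x) (ty : t • y = y⁻¹)
    (hx : x ≠ 0) (hy : y ≠ 0) (hne : ∀ p q : ℕ, p ≠ 0 ∨ q ≠ 0 → 1 - x ^ p * y ^ q ≠ 0) :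
    lusztig c u s k k x * (lusztig c u t k k y * lusztig c u s k k x)
      = lusztig c u t k k y * (lusztig c u s k k x * lusztig c u t k k y) := by
  have nx : 1 - x ^ 2 ≠ 0 := by simpa using hne 2 0 (by simp)
  have ny : 1 - y ^ 2 ≠ 0 := by simpa using hne 0 2 (by simp)
  have nxy : 1 - (x * y) ^ 2 ≠ 0 := by simpa [mul_pow] using hne 2 2 (by simp)
  have sA := (smul_dFunction s k k x).trans (sx ▸ dFunction_inv k k hx nx)
  have tB := (smul_dFunction t k k y).trans (ty ▸ dFunction_inv k k hy ny)
  have sB : s • dFunction k k y = dFunction k k (x * y) := by rw [smul_dFunction, sy]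
  have tA : t • dFunction k k x = dFunction k k (x * y) := by rw [smul_dFunction, tx, mul_comm]
  have sC : s • dFunction k k (x * y) = dFunction k k y := by
    rw [← sB, ← mul_smul, hs, one_smul]
  have tC : t • dFunction k k (x * y) = dFunction k k x := by
    rw [← tA, ← mul_smul, ht, one_smul]
  have hq : algebraMap 𝕜 K (k + k⁻¹) = algebraMap 𝕜 K k + (algebraMap 𝕜 K k)⁻¹ := by
    rw [map_add, map_inv₀]
  have key := typeA_identity ((map_ne_zero (algebraMap 𝕜 K)).2 hk) (by simpa using hne 1 0 (by simp))
    (by simpa using hne 0 1 (by simp)) (by simpa using hne 1 1 (by simp))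
    (dFunction_self k nx) (dFunction_self k ny) (dFunction_self k nxy)
  rw [← hq] at key
  -- The same lemma is applied with s and t interchanged. By the braid relation in the group, both
  -- results have the same dihedral sum.
  have k1 := kl_three hc hs sA sB tA tB sC tC (smul_algebraMap _ _) key
  have k2 := kl_three hc ht tB tA sB sA tC sC (smul_algebraMap _ _) (by linear_combination key)
  refine braid_three hk rfl rfl (theta_sq hc hs sx hx nx) (theta_sq hc ht ty hy ny) ?_
  refine k1.trans (Eq.trans ?_ k2.symm)
  rw [mul_comm (dFunction k k y) (dFunction k k x)]
  congr 1
  have hb := congrArg u hst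
  simp only [map_mul] at hb ⊢
  simp only [mul_add, add_mul, mul_one, one_mul, hb]
  abel

theorem lusztig_braid_four (hk : k ≠ 0) (hl : l ≠ 0) (hv : v ≠ 0)
    (hst : s * (t * (s * t)) = t * (s * (t * s)))
    (sx : s • x = x⁻¹) (sy : s • y = x ^ 2 * y) (tx : t • x = y * x) (ty : t • y = y⁻¹)
    (hx : x ≠ 0) (hy : y ≠ 0) (hne : ∀ p q : ℕ, p ≠ 0 ∨ q ≠ 0 → 1 - x ^ p * y ^ q ≠ 0) :
    lusztig c u s k v x * (lusztig c u t l l y * (lusztig c u s k v x * lusztig c u t l l y))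
      = lusztig c u t l l y * (lusztig c u s k v x *
        (lusztig c u t l l y * lusztig c u s k v x)) := by
  have nx : 1 - x ^ 2 ≠ 0 := by simpa using hne 2 0 (by simp)
  have ny : 1 - y ^ 2 ≠ 0 := by simpa using hne 0 2 (by simp)
  have nxy : 1 - (x ^ 2 * y) ^ 2 ≠ 0 := by simpa [mul_pow, ← pow_mul] using hne 4 2 (by simp)
  have sA := (smul_dFunction s k v x).trans (sx ▸ dFunction_inv k v hx nx)
  have tB := (smul_dFunction t l l y).trans (ty ▸ dFunction_inv l l hy ny)
  have tA : t • dFunction k v x = dFunction k v (x * y) := by rw [smul_dFunction, tx, mul_comm]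
  have tA1 : t • dFunction k v (x * y) = dFunction k v x := by rw [← tA, ← mul_smul, ht, one_smul]
  have sB : s • dFunction l l y = dFunction l l (x ^ 2 * y) := by rw [smul_dFunction, sy]
  have sB1 : s • dFunction l l (x ^ 2 * y) = dFunction l l y := by
    rw [← sB, ← mul_smul, hs, one_smul]
  have sA1 : s • dFunction k v (x * y) = dFunction k v (x * y) := by
    rw [smul_dFunction, smul_mul', sx, sy]
    congr 1
    field_simp
  have tB1 : t • dFunction l l (x ^ 2 * y) = dFunction l l (x ^ 2 * y) := by
    rw [smul_dFunction, smul_mul', smul_pow', tx, ty]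
    congr 1
    field_simp
  have hp : algebraMap 𝕜 K (k + k⁻¹) = algebraMap 𝕜 K k + (algebraMap 𝕜 K k)⁻¹ := by
    rw [map_add, map_inv₀]
  have hq : algebraMap 𝕜 K (l + l⁻¹) = algebraMap 𝕜 K l + (algebraMap 𝕜 K l)⁻¹ := by
    rw [map_add, map_inv₀]
  have hr : algebraMap 𝕜 K (k * l⁻¹ + l * k⁻¹) = algebraMap 𝕜 K k * (algebraMap 𝕜 K l)⁻¹
      + algebraMap 𝕜 K l * (algebraMap 𝕜 K k)⁻¹ := by
    simp only [map_add, map_mul, map_inv₀]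
  have key := typeB_identity (x := x) (y := y) (A := dFunction k v x)
    (A1 := dFunction k v (x * y)) ((map_ne_zero (algebraMap 𝕜 K)).2 hk)
    ((map_ne_zero (algebraMap 𝕜 K)).2 hl) ((map_ne_zero (algebraMap 𝕜 K)).2 hv) nx
    (by simpa using hne 0 1 (by simp)) (hne 2 2 (by simp))
    (by simpa using hne 2 1 (by simp)) rfl (dFunction_self l ny)
    (by rw [dFunction, mul_pow]) (dFunction_self l nxy)
  rw [← hp, ← hq, ← hr] at key
  have k1 := kl_four hc hs ht sA sB tA tB sA1 tA1 sB1 tB1 (smul_algebraMap _ _) key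
  have k2 := kl_four hc ht hs (r := k * l⁻¹ + l * k⁻¹) tB tA sB sA tB1 sB1 tA1 sA1
    (smul_algebraMap _ _) (by linear_combination key)
  have hb := congrArg u hst
  refine braid_four hk hl rfl rfl (theta_sq hc hs sx hx nx) (theta_sq hc ht ty hy ny) ?_
  simp only [← mul_assoc] at k1 k2 ⊢
  refine k1.trans (Eq.trans ?_ k2.symm)
  rw [show dFunction l l y * dFunction k v x * dFunction l l (x ^ 2 * y) * dFunction k v (x * y)
    = dFunction k v x * dFunction l l y * dFunction k v (x * y) * dFunction l l (x ^ 2 * y) by ring]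
  congr 1
  simp only [map_mul] at hb ⊢
  simp only [mul_add, add_mul, mul_one, one_mul, mul_assoc, hb]
  abel

theorem lusztig_braid_six (hk : k ≠ 0) (hl : l ≠ 0)
    (hst : s * (t * (s * (t * (s * t)))) = t * (s * (t * (s * (t * s)))))
    (sx : s • x = x⁻¹) (sy : s • y = x ^ 3 * y) (tx : t • x = y * x) (ty : t • y = y⁻¹)
    (hx : x ≠ 0) (hy : y ≠ 0) (hne : ∀ p q : ℕ, p ≠ 0 ∨ q ≠ 0 → 1 - x ^ p * y ^ q ≠ 0) :
    lusztig c u s k k x * (lusztig c u t l l y * (lusztig c u s k k x * (lusztig c u t l l y *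
        (lusztig c u s k k x * lusztig c u t l l y))))
      = lusztig c u t l l y * (lusztig c u s k k x * (lusztig c u t l l y *
        (lusztig c u s k k x * (lusztig c u t l l y * lusztig c u s k k x)))) := by
  have nx : 1 - x ^ 2 ≠ 0 := by simpa using hne 2 0 (by simp)
  have ny : 1 - y ^ 2 ≠ 0 := by simpa using hne 0 2 (by simp)
  have nA1 : 1 - (x * y) ^ 2 ≠ 0 := by simpa [mul_pow] using hne 2 2 (by simp)
  have nA2 : 1 - (x ^ 2 * y) ^ 2 ≠ 0 := by simpa [mul_pow, ← pow_mul] using hne 4 2 (by simp)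
  have nB1 : 1 - (x ^ 3 * y) ^ 2 ≠ 0 := by simpa [mul_pow, ← pow_mul] using hne 6 2 (by simp)
  have nB2 : 1 - (x ^ 3 * y ^ 2) ^ 2 ≠ 0 := by
    simpa [mul_pow, ← pow_mul] using hne 6 4 (by simp)
  have sA := (smul_dFunction s k k x).trans (sx ▸ dFunction_inv k k hx nx)
  have tB := (smul_dFunction t l l y).trans (ty ▸ dFunction_inv l l hy ny)
  have tA : t • dFunction k k x = dFunction k k (x * y) := by rw [smul_dFunction, tx, mul_comm]
  have tA1 : t • dFunction k k (x * y) = dFunction k k x := by rw [← tA, ← mul_smul, ht, one_smul]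
  have sA1 : s • dFunction k k (x * y) = dFunction k k (x ^ 2 * y) := by
    rw [smul_dFunction, smul_mul', sx, sy]
    congr 1
    field_simp
  have sA2 : s • dFunction k k (x ^ 2 * y) = dFunction k k (x * y) := by
    rw [← sA1, ← mul_smul, hs, one_smul]
  have tA2 : t • dFunction k k (x ^ 2 * y) = dFunction k k (x ^ 2 * y) := by
    rw [smul_dFunction, smul_mul', smul_pow', tx, ty]
    congr 1
    field_simp
  have sB : s • dFunction l l y = dFunction l l (x ^ 3 * y) := by rw [smul_dFunction, sy]
  have sB1 : s • dFunction l l (x ^ 3 * y) = dFunction l l y := by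
    rw [← sB, ← mul_smul, hs, one_smul]
  have sB2 : s • dFunction l l (x ^ 3 * y ^ 2) = dFunction l l (x ^ 3 * y ^ 2) := by
    rw [smul_dFunction, smul_mul', smul_pow', smul_pow', sx, sy]
    congr 1
    field_simp
  have tB1 : t • dFunction l l (x ^ 3 * y) = dFunction l l (x ^ 3 * y ^ 2) := by
    rw [smul_dFunction, smul_mul', smul_pow', tx, ty]
    congr 1
    field_simp
  have tB2 : t • dFunction l l (x ^ 3 * y ^ 2) = dFunction l l (x ^ 3 * y) := by
    rw [← tB1, ← mul_smul, ht, one_smul]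
  have hp : algebraMap 𝕜 K (k + k⁻¹) = algebraMap 𝕜 K k + (algebraMap 𝕜 K k)⁻¹ := by
    rw [map_add, map_inv₀]
  have hq : algebraMap 𝕜 K (l + l⁻¹) = algebraMap 𝕜 K l + (algebraMap 𝕜 K l)⁻¹ := by
    rw [map_add, map_inv₀]
  have hr : algebraMap 𝕜 K (2 * (k * l⁻¹ + l * k⁻¹)) = 2 * (algebraMap 𝕜 K k *
      (algebraMap 𝕜 K l)⁻¹ + algebraMap 𝕜 K l * (algebraMap 𝕜 K k)⁻¹) := by
    simp only [map_add, map_mul, map_inv₀, map_ofNat]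
  have hr' : algebraMap 𝕜 K ((k * l⁻¹ + l * k⁻¹) ^ 2 - 1) = (algebraMap 𝕜 K k *
      (algebraMap 𝕜 K l)⁻¹ + algebraMap 𝕜 K l * (algebraMap 𝕜 K k)⁻¹) ^ 2 - 1 := by
    simp only [map_add, map_mul, map_inv₀, map_sub, map_pow, map_one]
  have hk' := (map_ne_zero (algebraMap 𝕜 K)).2 hk
  have hl' := (map_ne_zero (algebraMap 𝕜 K)).2 hl
  have n1 : 1 - x ≠ 0 := by simpa using hne 1 0 (by simp)
  have n2 : 1 - y ≠ 0 := by simpa using hne 0 1 (by simp)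
  have n3 : 1 - x * y ≠ 0 := by simpa using hne 1 1 (by simp)
  have n4 : 1 - x ^ 2 * y ≠ 0 := by simpa using hne 2 1 (by simp)
  have n5 : 1 - x ^ 3 * y ≠ 0 := by simpa using hne 3 1 (by simp)
  have n6 : 1 - x ^ 3 * y ^ 2 ≠ 0 := hne 3 2 (by simp)
  have eA := dFunction_self k nx
  have eB := dFunction_self l ny
  have eA1 := dFunction_self k nA1
  have eA2 := dFunction_self k nA2
  have eB1 := dFunction_self l nB1
  have eB2 := dFunction_self l nB2
  have key1 := typeG_identity_short hk' hl' n1 n2 n3 n4 n5 n6 eA eB eA1 eA2 eB1 eB2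
  have key2 := typeG_identity_long hk' hl' n1 n2 n3 n4 n5 n6 eA eB eA1 eA2 eB1 eB2
  have key3 := typeG_identity_quartic hk' hl' n1 n2 n3 n4 n5 n6 eA eB eA1 eA2 eB1 eB2
  rw [← hp, ← hq, ← hr] at key1 key2 key3
  rw [← hr'] at key3
  clear eA eB eA1 eA2 eB1 eB2
  have k1 := kl_six hc hs ht sA sA1 sA2 sB sB1 sB2 tA tA1 tA2 tB tB1 tB2 (smul_algebraMap _ _)
    (smul_algebraMap _ _) (smul_algebraMap _ _) (smul_algebraMap _ _) key1 key3
  have k2 := kl_six hc ht hs tB tB1 tB2 tA tA1 tA2 sB sB1 sB2 sA sA1 sA2 (smul_algebraMap _ _)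
    (smul_algebraMap _ _) (smul_algebraMap _ _) (smul_algebraMap _ _)
    (b := 2 * (k * l⁻¹ + l * k⁻¹)) (d := (k * l⁻¹ + l * k⁻¹) ^ 2 - 1)
    (by linear_combination key2) (by linear_combination key3)
  have hb := congrArg u hst
  refine braid_six hk hl rfl rfl (theta_sq hc hs sx hx nx) (theta_sq hc ht ty hy ny) ?_
  simp only [← mul_assoc] at k1 k2 ⊢
  refine k1.trans (Eq.trans ?_ k2.symm)
  rw [show dFunction l l y * dFunction k k x * dFunction l l (x ^ 3 * y) * dFunction k k (x * y)
      * dFunction l l (x ^ 3 * y ^ 2) * dFunction k k (x ^ 2 * y)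
    = dFunction k k x * dFunction l l y * dFunction k k (x * y) * dFunction l l (x ^ 3 * y)
      * dFunction k k (x ^ 2 * y) * dFunction l l (x ^ 3 * y ^ 2) by ring]
  congr 1
  simp only [map_mul] at hb ⊢
  simp only [mul_add, add_mul, mul_one, one_mul, mul_assoc, hb]
  abel

end RankTwo

end

noncomputable section

/-! ### The Demazure–Lusztig elements -/

namespace AffineRootSystem

open AffineRoot ReducedWord RankTwo

variable {V P : Type*} [NormedAddCommGroup V] [InnerProductSpace ℝ V] [FiniteDimensional ℝ V]
  [MetricSpace P] [NormedAddTorsor V P] (R : AffineRootSystem V P)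

theorem e_add (x y : R.rootLattice) : R.e (x + y) = R.e x * R.e y := by
  rw [e, e, e, ← map_mul, AddMonoidAlgebra.single_mul_single, one_mul]

theorem e_zero : R.e 0 = 1 := by
  rw [e, ← AddMonoidAlgebra.one_def, map_one]

theorem e_neg (x : R.rootLattice) : R.e (-x) = (R.e x)⁻¹ :=
  eq_inv_of_mul_eq_one_left (by rw [← e_add, neg_add_cancel, e_zero])

theorem e_nsmul (m : ℕ) (x : R.rootLattice) : R.e (m • x) = R.e x ^ m := by
  induction m with
  | zero => rw [zero_smul, e_zero, pow_zero]
  | succ m ih => rw [succ_nsmul, e_add, ih, pow_succ]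

theorem e_injective : Function.Injective R.e := fun _ _ h =>
  (AddMonoidAlgebra.single_left_inj one_ne_zero).1 (IsFractionRing.injective R.GroupAlg R.F h)

theorem one_sub_e_ne_zero {x : R.rootLattice} (hx : x ≠ 0) : 1 - R.e x ≠ 0 := by
  rw [sub_ne_zero, ← e_zero]
  exact fun h => hx (R.e_injective h.symm)

theorem e_ne_zero (x : R.rootLattice) : R.e x ≠ 0 := by
  intro h
  have := R.e_add x (-x)
  rw [h, zero_mul, add_neg_cancel, e_zero] at this
  exact one_ne_zero this

/-- The embedding of `F` into `W ⋉ F` as an algebra homomorphism. -/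
def ofFHom : R.F →ₐ[ℂ] R.WF :=
  { SkewMonoidAlgebra.singleOneRingHom with
    commutes' := fun r => by rw [SkewMonoidAlgebra.coe_algebraMap]; rfl }

/-- The embedding of `W` into `W ⋉ F` as a monoid homomorphism. -/
def ofWHom : R.weylGroup →* R.WF := SkewMonoidAlgebra.of R.F R.weylGroup

theorem ofWHom_mul_ofFHom (w : R.weylGroup) (f : R.F) :
    R.ofWHom w * R.ofFHom f = R.ofFHom (w • f) * R.ofWHom w := by
  change SkewMonoidAlgebra.single w 1 * SkewMonoidAlgebra.single 1 f =
    SkewMonoidAlgebra.single 1 (w • f) * SkewMonoidAlgebra.single w 1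
  simp [SkewMonoidAlgebra.single_mul_single]

namespace OrderedBasis

variable {R} {n : ℕ} (Δ : R.OrderedBasis n)

/-- The element `e^{a_i}`. -/
def expRoot (i : Fin (n + 1)) : R.F := R.e (R.rootInLattice (Δ.simpleRoot i))

theorem expRoot_ne_zero (i : Fin (n + 1)) : Δ.expRoot i ≠ 0 := R.e_ne_zero _

theorem smul_expRoot_self (i : Fin (n + 1)) :
    Δ.simpleReflection i • Δ.expRoot i = (Δ.expRoot i)⁻¹ := by
  rw [expRoot, smul_e, ← e_neg]
  congr 1
  apply Subtype.ext
  change act _ (Δ.root i) = -Δ.root i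
  rw [act_simpleReflection, pairing_self (R.nonisotropic _ (Δ.mem i))]
  module

theorem smul_expRoot {i j : Fin (n + 1)} {m : ℕ} (h : Δ.cartanMatrix i j = -m) :
    Δ.simpleReflection i • Δ.expRoot j = Δ.expRoot i ^ m * Δ.expRoot j := by
  rw [expRoot, smul_e, expRoot, ← e_nsmul, ← e_add]
  congr 1
  apply Subtype.ext
  change act _ (Δ.root j) = m • Δ.root i + Δ.root j
  rw [act_simpleReflection, pairing_root, h]
  push_cast
  module

theorem expRoot_relation_ne_zero {i j : Fin (n + 1)} (hij : i ≠ j) (p q : ℕ) (h : p ≠ 0 ∨ q ≠ 0) :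
    1 - Δ.expRoot i ^ p * Δ.expRoot j ^ q ≠ 0 := by
  rw [expRoot, expRoot, ← e_nsmul, ← e_nsmul, ← e_add]
  refine R.one_sub_e_ne_zero fun h0 => ?_
  have h1 : p • Δ.root i + q • Δ.root j = 0 := congrArg Subtype.val h0
  rw [← Nat.cast_smul_eq_nsmul ℝ, ← Nat.cast_smul_eq_nsmul ℝ] at h1
  have h2 := congrArg (fun a => Δ.basis.repr a i) h1
  have h3 := congrArg (fun a => Δ.basis.repr a j) h1
  simp [coord_root, hij, hij.symm] at h2 h3
  lia

theorem one_sub_expRoot_sq_ne_zero (i : Fin (n + 1)) : 1 - Δ.expRoot i ^ 2 ≠ 0 := by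
  rw [expRoot, ← e_nsmul]
  refine R.one_sub_e_ne_zero fun h0 => ?_
  have h1 : 2 • Δ.root i = 0 := congrArg Subtype.val h0
  rw [← Nat.cast_smul_eq_nsmul ℝ] at h1
  have h2 := congrArg (fun a => Δ.basis.repr a i) h1
  simp [coord_root] at h2

/-- If 2a_i is a root, its coroot is a_i^∨/2, so integrality forces every a_ij to be even. An odd
entry therefore puts k_{2a_i} under the convention k_{2a} = k_a. -/
theorem kTwo_eq {k : R.roots → ℂˣ} {i j : Fin (n + 1)} (h : ¬ (2 : ℤ) ∣ Δ.cartanMatrix i j) :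
    R.kTwo k (Δ.simpleRoot i) = k (Δ.simpleRoot i) := by
  rw [kTwo, dif_neg]
  intro hmem
  obtain ⟨z, hz⟩ := R.integral _ hmem _ (Δ.mem j)
  change pairing ((2 : ℝ) • Δ.root i) (Δ.root j) = z at hz
  rw [pairing_smul_left two_ne_zero, pairing_root] at hz
  refine h ⟨z, ?_⟩
  have : (Δ.cartanMatrix i j : ℝ) = 2 * z := by linarith
  exact_mod_cast this

/-- The Demazure–Lusztig element of `W ⋉ F` attached to a simple affine root. -/
def demazureLusztig (k : R.roots → ℂˣ) (i : Fin (n + 1)) : R.WF :=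
  (k (Δ.simpleRoot i) : ℂ) • R.ofW (R.s (Δ.simpleRoot i)) +
    R.ofF (R.cFunction k (Δ.simpleRoot i)) * (1 - R.ofW (R.s (Δ.simpleRoot i)))

theorem demazureLusztig_eq (k : R.roots → ℂˣ) (i : Fin (n + 1)) :
    Δ.demazureLusztig k i = lusztig R.ofFHom R.ofWHom (Δ.simpleReflection i)
      (k (Δ.simpleRoot i) : ℂ) (R.kTwo k (Δ.simpleRoot i) : ℂ) (Δ.expRoot i) := by
  rw [lusztig_eq R.ofWHom_mul_ofFHom (Δ.smul_expRoot_self i) (Δ.expRoot_ne_zero i)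
    (Δ.one_sub_expRoot_sq_ne_zero i), expRoot, ← e_nsmul]
  rfl

theorem demazureLusztig_quadratic (k : R.roots → ℂˣ) (i : Fin (n + 1)) :
    (Δ.demazureLusztig k i - algebraMap ℂ R.WF (k (Δ.simpleRoot i))) *
      (Δ.demazureLusztig k i + algebraMap ℂ R.WF (k (Δ.simpleRoot i) : ℂ)⁻¹) = 0 := by
  rw [demazureLusztig_eq]
  exact lusztig_quadratic R.ofWHom_mul_ofFHom (Δ.simpleReflection_mul_self i)
    (Δ.smul_expRoot_self i) (Δ.expRoot_ne_zero i) (Δ.one_sub_expRoot_sq_ne_zero i)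

theorem smul_expRoot_eq_mul {i j : Fin (n + 1)} (h : Δ.cartanMatrix i j = -1) :
    Δ.simpleReflection i • Δ.expRoot j = Δ.expRoot i * Δ.expRoot j := by
  rw [Δ.smul_expRoot (m := 1) (by simpa using h), pow_one]

/-- The two roots are conjugate: s_j a_i = a_i + a_j and s_i(a_i + a_j) = a_j. -/
theorem k_eq_of_cartanMatrix {k : R.roots → ℂˣ}
    (hk : ∀ (w : R.weylGroup) (a : R.roots), k (R.rootAct w a) = k a) {i j : Fin (n + 1)}
    (h : Δ.cartanMatrix i j = -1) (h' : Δ.cartanMatrix j i = -1) :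
    k (Δ.simpleRoot i) = k (Δ.simpleRoot j) := by
  rw [← hk (Δ.simpleReflection i * Δ.simpleReflection j) (Δ.simpleRoot i)]
  congr 1
  apply Subtype.ext
  change act _ (Δ.root i) = Δ.root j
  have h0 : Δ.root i = 0 + (1 : ℝ) • Δ.root i + (0 : ℝ) • Δ.root j := by module
  have hz (a : P →ᵃ[ℝ] ℝ) : pairing a 0 = 0 := by simpa using pairing_smul a 0 0
  rw [Subgroup.coe_mul, act_mul, h0, act_simpleReflection_add', act_simpleReflection_add, h, h',
    hz, hz]
  push_cast
  module

section

variable {k : R.roots → ℂˣ} {i j : Fin (n + 1)} (hij : i ≠ j)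
include hij

theorem demazureLusztig_braid_two (h : Δ.cartanMatrix i j = 0) (h' : Δ.cartanMatrix j i = 0)
    (hs : wordProd Δ.simpleReflection (altList i j 2) =
      wordProd Δ.simpleReflection (altList j i 2)) :
    wordProd (Δ.demazureLusztig k) (altList i j 2) =
      wordProd (Δ.demazureLusztig k) (altList j i 2) := by
  simp only [altList, wordProd_cons, wordProd_nil, mul_one, demazureLusztig_eq] at hs ⊢
  refine lusztig_comm R.ofWHom_mul_ofFHom hs ?_ ?_
  · rw [Δ.smul_expRoot (m := 0) (by simpa using h), pow_zero, one_mul]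
  · rw [Δ.smul_expRoot (m := 0) (by simpa using h'), pow_zero, one_mul]

theorem demazureLusztig_braid_three
    (hk : ∀ (w : R.weylGroup) (a : R.roots), k (R.rootAct w a) = k a)
    (h : Δ.cartanMatrix i j = -1) (h' : Δ.cartanMatrix j i = -1)
    (hs : wordProd Δ.simpleReflection (altList i j 3) =
      wordProd Δ.simpleReflection (altList j i 3)) :
    wordProd (Δ.demazureLusztig k) (altList i j 3) =
      wordProd (Δ.demazureLusztig k) (altList j i 3) := by
  simp only [altList, wordProd_cons, wordProd_nil, mul_one, demazureLusztig_eq] at hs ⊢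
  rw [Δ.kTwo_eq (i := i) (j := j) (by rw [h]; decide),
    Δ.kTwo_eq (i := j) (j := i) (by rw [h']; decide), ← Δ.k_eq_of_cartanMatrix hk h h']
  exact lusztig_braid_three R.ofWHom_mul_ofFHom (Δ.simpleReflection_mul_self i)
    (Δ.simpleReflection_mul_self j) (Units.ne_zero _) hs (Δ.smul_expRoot_self i)
    (Δ.smul_expRoot_eq_mul h) (Δ.smul_expRoot_eq_mul h') (Δ.smul_expRoot_self j)
    (Δ.expRoot_ne_zero i) (Δ.expRoot_ne_zero j) (Δ.expRoot_relation_ne_zero hij)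

/-- The odd entry a_ji excludes 2a_j from the roots, but a_ij = -2 allows 2a_i, so k_{2a_i} stays a
free third parameter. -/
theorem demazureLusztig_braid_four
    (h : Δ.cartanMatrix i j = -2) (h' : Δ.cartanMatrix j i = -1)
    (hs : wordProd Δ.simpleReflection (altList i j 4) =
      wordProd Δ.simpleReflection (altList j i 4)) :
    wordProd (Δ.demazureLusztig k) (altList i j 4) =
      wordProd (Δ.demazureLusztig k) (altList j i 4) := by
  simp only [altList, wordProd_cons, wordProd_nil, mul_one, demazureLusztig_eq] at hs ⊢
  rw [Δ.kTwo_eq (i := j) (j := i) (by rw [h']; decide)]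
  exact lusztig_braid_four R.ofWHom_mul_ofFHom (Δ.simpleReflection_mul_self i)
    (Δ.simpleReflection_mul_self j) (Units.ne_zero _) (Units.ne_zero _) (Units.ne_zero _) hs
    (Δ.smul_expRoot_self i) (Δ.smul_expRoot (by simpa using h)) (Δ.smul_expRoot_eq_mul h')
    (Δ.smul_expRoot_self j) (Δ.expRoot_ne_zero i) (Δ.expRoot_ne_zero j)
    (Δ.expRoot_relation_ne_zero hij)

theorem demazureLusztig_braid_six
    (h : Δ.cartanMatrix i j = -3) (h' : Δ.cartanMatrix j i = -1)
    (hs : wordProd Δ.simpleReflection (altList i j 6) =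
      wordProd Δ.simpleReflection (altList j i 6)) :
    wordProd (Δ.demazureLusztig k) (altList i j 6) =
      wordProd (Δ.demazureLusztig k) (altList j i 6) := by
  simp only [altList, wordProd_cons, wordProd_nil, mul_one, demazureLusztig_eq] at hs ⊢
  rw [Δ.kTwo_eq (i := i) (j := j) (by rw [h]; decide),
    Δ.kTwo_eq (i := j) (j := i) (by rw [h']; decide)]
  exact lusztig_braid_six R.ofWHom_mul_ofFHom (Δ.simpleReflection_mul_self i)
    (Δ.simpleReflection_mul_self j) (Units.ne_zero _) (Units.ne_zero _) hs
    (Δ.smul_expRoot_self i) (Δ.smul_expRoot (by simpa using h)) (Δ.smul_expRoot_eq_mul h')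
    (Δ.smul_expRoot_self j) (Δ.expRoot_ne_zero i) (Δ.expRoot_ne_zero j)
    (Δ.expRoot_relation_ne_zero hij)

theorem demazureLusztig_braid (hk : ∀ (w : R.weylGroup) (a : R.roots), k (R.rootAct w a) = k a)
    (m : ℕ) (hm : CartanHecke.braidExponent Δ.cartanMatrix i j = m) :
    wordProd (Δ.demazureLusztig k) (altList i j m) =
      wordProd (Δ.demazureLusztig k) (altList j i m) := by
  have hs := Δ.simpleReflection_braid hij m hm
  rcases Δ.cartan_cases hij with ⟨h1, h2, h3⟩ | ⟨h1, h2, h3⟩ | ⟨h1, h2, h3⟩ | ⟨h1, h2, h3⟩ |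
    ⟨h1, h2, h3⟩ | ⟨h1, h2, h3⟩ | ⟨h1, h3⟩ <;> rw [hm] at h3
  case inr.inr.inr.inr.inr.inr => exact absurd h3 (ENat.natCast_ne_top m)
  all_goals obtain rfl : m = _ := by exact_mod_cast h3
  · exact Δ.demazureLusztig_braid_two hij h1 h2 hs
  · exact Δ.demazureLusztig_braid_three hij hk h1 h2 hs
  · exact (Δ.demazureLusztig_braid_four hij.symm h2 h1 hs.symm).symm
  · exact Δ.demazureLusztig_braid_four hij h1 h2 hs
  · exact (Δ.demazureLusztig_braid_six hij.symm h2 h1 hs.symm).symm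
  · exact Δ.demazureLusztig_braid_six hij h1 h2 hs

end

end OrderedBasis

end AffineRootSystem

end

noncomputable section

/-! ### The universal property of Hecke algebras, and a spanning set -/

namespace CartanHecke

open ReducedWord

variable {ι : Type*} [DecidableEq ι] {A : Matrix ι ι ℤ} {k : ι → ℂˣ} {B : Type*} [Ring B]
  [Algebra ℂ B]

theorem map_altWord {M : Type*} [Monoid M] (f : FreeGroup ι →* M) (i j : ι) (m : ℕ) :
    f (altWord i j m) = wordProd (fun i => f (FreeGroup.of i)) (altList i j m) := by
  induction m generalizing i j with
  | zero => exact map_one f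
  | succ m ih => rw [altWord, map_mul, ih, altList, wordProd_cons]

theorem map_wordProd {M N : Type*} [Monoid M] [Monoid N] (f : M →* N) (s : ι → M) (l : List ι) :
    f (wordProd s l) = wordProd (fun i => f (s i)) l := by
  induction l with
  | nil => exact map_one f
  | cons i l ih => rw [wordProd_cons, map_mul, ih, wordProd_cons]

/-- The image of the braid group in the Hecke algebra. -/
def braidHom (A : Matrix ι ι ℤ) (k : ι → ℂˣ) : BraidGroup A →* HeckeAlgebra A k :=
  (RingQuot.mkAlgHom ℂ (HeckeRel A k) : _ →* HeckeAlgebra A k).comp (MonoidAlgebra.of ℂ _)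

theorem braidHom_of (i : ι) : braidHom A k (PresentedGroup.of i) = heckeT A k i := rfl

theorem heckeT_quadratic (i : ι) :
    (heckeT A k i - algebraMap ℂ _ (k i : ℂ)) * (heckeT A k i + algebraMap ℂ _ (k i : ℂ)⁻¹) = 0 := by
  have := RingQuot.mkAlgHom_rel ℂ (HeckeRel.quadratic (A := A) (k := k) i)
  rwa [map_mul, map_sub, map_add, AlgHom.commutes, AlgHom.commutes, map_zero] at this

theorem heckeT_braid {i j : ι} (hij : i ≠ j) (m : ℕ) (hm : braidExponent A i j = m) :
    wordProd (heckeT A k) (altList i j m) = wordProd (heckeT A k) (altList j i m) := by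
  have h : PresentedGroup.mk (braidRelations A) (altWord i j m) = PresentedGroup.mk _ (altWord j i m) :=
    PresentedGroup.mk_eq_mk_of_mul_inv_mem ⟨i, j, m, hij, hm, rfl⟩
  have := congrArg (braidHom A k) h
  rw [map_altWord, map_altWord, map_wordProd, map_wordProd] at this
  exact this

theorem mul_self_of_quadratic {κ : ℂˣ} {T : B}
    (h : (T - algebraMap ℂ B κ) * (T + algebraMap ℂ B (κ : ℂ)⁻¹) = 0) :
    T * T = algebraMap ℂ B (κ - (κ : ℂ)⁻¹) * T + 1 := by
  have h1 : algebraMap ℂ B κ * algebraMap ℂ B (κ : ℂ)⁻¹ = 1 := by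
    rw [← map_mul, mul_inv_cancel₀ κ.ne_zero, map_one]
  rw [sub_mul, mul_add, mul_add, h1, ← Algebra.commutes] at h
  rw [map_sub, sub_mul, ← sub_eq_zero, ← h]
  abel

/-- An element of an algebra satisfying a quadratic relation with roots `κ`, `-κ⁻¹` is a unit. -/
def unitOfQuadratic (κ : ℂˣ) (T : B)
    (h : (T - algebraMap ℂ B κ) * (T + algebraMap ℂ B (κ : ℂ)⁻¹) = 0) : Bˣ where
  val := T
  inv := T - algebraMap ℂ B (κ - (κ : ℂ)⁻¹)
  val_inv := by
    rw [mul_sub, mul_self_of_quadratic h, ← Algebra.commutes, add_sub_cancel_left]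
  inv_val := by
    rw [sub_mul, mul_self_of_quadratic h, add_sub_cancel_left]

/-- The homomorphism from the Hecke algebra defined by elements which satisfy the quadratic
relations and the braid relations. -/
def heckeLift (T : ι → B)
    (hq : ∀ i, (T i - algebraMap ℂ B (k i)) * (T i + algebraMap ℂ B (k i : ℂ)⁻¹) = 0)
    (hb : ∀ i j, i ≠ j → ∀ m : ℕ, braidExponent A i j = m →
      wordProd T (altList i j m) = wordProd T (altList j i m)) : HeckeAlgebra A k →ₐ[ℂ] B :=
  RingQuot.liftAlgHom ℂ ⟨MonoidAlgebra.lift ℂ B (BraidGroup A) ((Units.coeHom B).comp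
    (PresentedGroup.toGroup (f := fun i => unitOfQuadratic (k i) (T i) (hq i)) (by
      rintro _ ⟨i, j, m, hij, hm, rfl⟩
      rw [map_mul, map_inv, mul_inv_eq_one, map_altWord, map_altWord]
      apply Units.ext
      change Units.coeHom B _ = Units.coeHom B _
      simp only [map_wordProd, FreeGroup.lift_apply_of]
      exact hb i j hij m hm))), by
    rintro _ _ ⟨i⟩
    simp only [braidT, map_mul, map_sub, map_add, AlgHom.commutes, MonoidAlgebra.lift_of, map_zero,
      MonoidHom.comp_apply, PresentedGroup.toGroup.of]
    exact hq i⟩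

theorem heckeLift_heckeT (T : ι → B)
    (hq : ∀ i, (T i - algebraMap ℂ B (k i)) * (T i + algebraMap ℂ B (k i : ℂ)⁻¹) = 0)
    (hb : ∀ i j, i ≠ j → ∀ m : ℕ, braidExponent A i j = m →
      wordProd T (altList i j m) = wordProd T (altList j i m)) (i : ι) :
    heckeLift T hq hb (heckeT A k i) = T i := by
  rw [heckeLift, heckeT, RingQuot.liftAlgHom_mkAlgHom_apply, braidT, MonoidAlgebra.lift_of,
    MonoidHom.comp_apply, PresentedGroup.toGroup.of]
  rfl

/-- The group algebra also contains the inverses of the generators. Passing to homomorphisms into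
the units of B shows that their images are determined too. -/
theorem hecke_hom_ext {f g : HeckeAlgebra A k →ₐ[ℂ] B}
    (h : ∀ i, f (heckeT A k i) = g (heckeT A k i)) : f = g := by
  refine RingQuot.ringQuot_ext' _ _ _
    ((MonoidAlgebra.lift ℂ B (BraidGroup A)).symm.injective (MonoidHom.ext fun x => ?_))
  let f' : BraidGroup A →* B := (f : _ →* B).comp (braidHom A k)
  let g' : BraidGroup A →* B := (g : _ →* B).comp (braidHom A k)
  have : f'.toHomUnits = g'.toHomUnits := PresentedGroup.ext fun i => Units.ext (h i)
  exact congrArg Units.val (DFunLike.congr_fun this x)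

section Span

variable {G : Type*} [Group G] {s : ι → G} {N : G → ι → Prop} (D : DescentSystem s N)
  (hN : ∀ i j, i ≠ j → ∀ n : ℕ, ((n + 1 : ℕ) : ℕ∞) ≤ braidExponent A i j →
    ¬ N (wordProd s (altList j i n)) i)
  (hsymm : ∀ i j, braidExponent A i j = braidExponent A j i)
  (hs : ∀ i j, i ≠ j → ∀ n : ℕ, braidExponent A i j = n →
    wordProd s (altList i j n) = wordProd s (altList j i n))
  (hpos : ∀ i j, braidExponent A i j ≠ 0)
include D hN hsymm hs hpos

/-- The span of the elements `T_w` is stable under left multiplication by the `T_i`. -/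
theorem heckeT_mul_mem_span (i : ι) {x : HeckeAlgebra A k}
    (hx : x ∈ Submodule.span ℂ {x | ∃ l, IsReduced s l ∧ wordProd (heckeT A k) l = x}) :
    heckeT A k i * x ∈ Submodule.span ℂ {x | ∃ l, IsReduced s l ∧ wordProd (heckeT A k) l = x} := by
  have up {l : List ι} (hl : IsReduced s l) (h : ¬ N (wordProd s l) i) :
      heckeT A k i * wordProd (heckeT A k) l ∈
        Submodule.span ℂ {x | ∃ l, IsReduced s l ∧ wordProd (heckeT A k) l = x} :=
    Submodule.subset_span ⟨i :: l, (D.isReduced_cons_iff hl i).2 h, wordProd_cons _ _ _⟩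
  induction hx using Submodule.span_induction with
  | mem x h =>
    obtain ⟨l, hl, rfl⟩ := h
    by_cases hi : N (wordProd s l) i
    -- Write w = s_i w' with w' shorter. Matsumoto's theorem gives T_w = T_i T_{w'}, and the
    -- quadratic relation then expresses T_i T_w through T_w and T_{w'}.
    · obtain ⟨l', hl', e⟩ := exists_isReduced s (i :: l)
      have hi' : ¬ N (wordProd s l') i := by
        rw [e, wordProd_cons, D.mul_left, not_not]; exact hi
      have e' : wordProd s l = wordProd s (i :: l') := by
        rw [wordProd_cons, e, wordProd_cons, D.inv_mul_cancel_left]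
      have := D.matsumoto hN hsymm hs (T := heckeT A k)
        (fun i j hij n hn => heckeT_braid hij n hn) hpos hl
        ((D.isReduced_cons_iff hl' i).2 hi') e'
      rw [this, wordProd_cons, ← mul_assoc, mul_self_of_quadratic (heckeT_quadratic i), add_mul,
        one_mul, mul_assoc, ← Algebra.smul_def]
      exact add_mem (Submodule.smul_mem _ _ (up hl' hi')) (Submodule.subset_span ⟨l', hl', rfl⟩)
    · exact up hl hi
  | zero => rw [mul_zero]; exact zero_mem _
  | add x y _ _ hx hy => rw [mul_add]; exact add_mem hx hy
  | smul c x _ hx => rw [mul_smul_comm]; exact Submodule.smul_mem _ _ hx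

/-- The Hecke algebra is spanned by the elements `T_w`. -/
theorem span_wordProd_heckeT :
    Submodule.span ℂ {x | ∃ l, IsReduced s l ∧ wordProd (heckeT A k) l = x} = ⊤ := by
  set S := Submodule.span ℂ {x | ∃ l, IsReduced s l ∧ wordProd (heckeT A k) l = x}
  have hmul (i : ι) {x : HeckeAlgebra A k} (hx : x ∈ S) : heckeT A k i * x ∈ S :=
    heckeT_mul_mem_span D hN hsymm hs hpos i hx
  have hinv (i : ι) {x : HeckeAlgebra A k} (hx : x ∈ S) :
      braidHom A k (PresentedGroup.of i)⁻¹ * x ∈ S := by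
    have e : braidHom A k (PresentedGroup.of i)⁻¹ =
        heckeT A k i - algebraMap ℂ _ (k i - (k i : ℂ)⁻¹) :=
      left_inv_eq_right_inv (a := heckeT A k i)
        (by rw [← braidHom_of, ← map_mul, inv_mul_cancel, map_one])
        (unitOfQuadratic (k i) (heckeT A k i) (heckeT_quadratic i)).val_inv
    rw [e, sub_mul, ← Algebra.smul_def]
    exact sub_mem (hmul i hx) (S.smul_mem _ hx)
  have hgroup (b : BraidGroup A) : ∀ x ∈ S, braidHom A k b * x ∈ S := by
    have hb : b ∈ Subgroup.closure (Set.range PresentedGroup.of) := by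
      rw [PresentedGroup.closure_range_of]; trivial
    induction hb using Subgroup.closure_induction'' with
    | one => intro x hx; rwa [map_one, one_mul]
    | mem _ h => obtain ⟨i, rfl⟩ := h; exact fun x => hmul i
    | inv_mem _ h => obtain ⟨i, rfl⟩ := h; exact fun x => hinv i
    | mul a b _ _ ha hb => intro x hx; rw [map_mul, mul_assoc]; exact ha _ (hb x hx)
  have hone : (1 : HeckeAlgebra A k) ∈ S := Submodule.subset_span ⟨[], isReduced_nil s, rfl⟩
  rw [eq_top_iff]
  rintro x -
  obtain ⟨y, rfl⟩ := RingQuot.mkAlgHom_surjective ℂ (HeckeRel A k) x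
  induction y using MonoidAlgebra.induction_on with
  | of b => exact mul_one (braidHom A k b) ▸ hgroup b 1 hone
  | add a b ha hb => rw [map_add]; exact add_mem ha hb
  | smul c a ha => rw [map_smul]; exact S.smul_mem _ ha

end Span

end CartanHecke

end

noncomputable section

/-! ### Triangularity of products along words in a skew group algebra -/

namespace SkewMonoidAlgebra

open ReducedWord

variable {ι 𝕜 G K : Type*} [Group G] [Field 𝕜] [Field K] [Algebra 𝕜 K] [MulSemiringAction G K]
  [SMulCommClass G 𝕜 K] {s : ι → G} {T : ι → SkewMonoidAlgebra K G} {f g : ι → K}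
  (hT : ∀ i, T i = single 1 (f i) + single (s i) (g i))
include hT

theorem coeff_wordProd_cons (i : ι) (l : List ι) (w : G) :
    (wordProd T (i :: l)).coeff w = f i * (wordProd T l).coeff w +
      g i * s i • (wordProd T l).coeff ((s i)⁻¹ * w) := by
  rw [wordProd_cons, hT, add_mul, coeff_add, Finsupp.add_apply, coeff_single_one_mul,
    coeff_single_mul]

/-- Expanding the product chooses 1 or s i for each letter. Choosing s i throughout gives the full
product, and any other choice gives the product of a shorter word. -/
theorem exists_of_coeff_wordProd_ne_zero (l : List ι) (w : G) (h : (wordProd T l).coeff w ≠ 0) :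
    w = wordProd s l ∨ ∃ l' : List ι, l'.length < l.length ∧ wordProd s l' = w := by
  induction l generalizing w with
  | nil =>
    left
    by_contra hw
    classical
    rw [wordProd_nil] at hw
    rw [wordProd_nil, coeff_one, Finsupp.single_apply, if_neg (Ne.symm hw)] at h
    exact h rfl
  | cons i l ih =>
    by_cases hw : (wordProd T l).coeff w = 0
    · rw [coeff_wordProd_cons hT, hw, mul_zero, zero_add] at h
      have h' : (wordProd T l).coeff ((s i)⁻¹ * w) ≠ 0 := fun h0 => by simp [h0] at h
      rcases ih _ h' with e | ⟨l', hl', e⟩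
      · left
        rw [wordProd_cons, ← e, mul_inv_cancel_left]
      · exact Or.inr ⟨i :: l', by simpa using hl', by rw [wordProd_cons, e, mul_inv_cancel_left]⟩
    · rcases ih _ hw with rfl | ⟨l', hl', e⟩
      · exact Or.inr ⟨l, by simp, rfl⟩
      · exact Or.inr ⟨l', by simp; lia, e⟩

/-- For a reduced word no shorter word reaches the top element, so its coefficient is the single
product of twisted conjugates of the g i, without cancellation. -/
theorem coeff_wordProd_ne_zero (hg : ∀ i, g i ≠ 0) {l : List ι} (hl : IsReduced s l) :
    (wordProd T l).coeff (wordProd s l) ≠ 0 := by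
  induction l with
  | nil => simp
  | cons i l ih =>
    have h0 : (wordProd T l).coeff (wordProd s (i :: l)) = 0 := by
      by_contra h
      rcases exists_of_coeff_wordProd_ne_zero hT l _ h with e | ⟨l', hl', e⟩
      · have := hl l e.symm
        simp at this
      · have := hl l' e
        simp at this
        lia
    rw [coeff_wordProd_cons hT, h0, mul_zero, zero_add, wordProd_cons, inv_mul_cancel_left]
    exact mul_ne_zero (hg i) ((smul_ne_zero_iff_ne _).2 (ih hl.of_cons))

/-- Products along reduced words of pairwise different group elements are linearly independent. -/
theorem linearIndependent_wordProd (hg : ∀ i, g i ≠ 0) {κ : Type*} {r : κ → List ι}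
    (hr : ∀ x, IsReduced s (r x)) (hinj : Function.Injective fun x => wordProd s (r x)) :
    LinearIndependent 𝕜 fun x => wordProd T (r x) := by
  classical
  rw [linearIndependent_iff']
  intro S c hc
  by_contra! hne
  obtain ⟨x₀, hx₀, hcx₀⟩ := hne
  -- Take a longest word occurring in the relation. At its group element every other occurring term
  -- has coefficient zero, as its support consists of a different top element and of products of
  -- strictly shorter words.
  obtain ⟨x, hx, hmax⟩ := (S.filter fun x => c x ≠ 0).exists_max_image (fun x => (r x).length)
    ⟨x₀, by simp [hx₀, hcx₀]⟩
  rw [Finset.mem_filter] at hx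
  let φ : SkewMonoidAlgebra K G →+ K :=
    (Finsupp.applyAddHom (wordProd s (r x))).comp coeffAddEquiv.toAddMonoidHom
  have h := congrArg φ hc
  rw [_root_.map_sum, _root_.map_zero] at h
  rw [Finset.sum_eq_single_of_mem x hx.1] at h
  · change (c x • wordProd T (r x)).coeff _ = 0 at h
    rw [coeff_smul, Finsupp.smul_apply] at h
    exact (smul_ne_zero hx.2 (coeff_wordProd_ne_zero hT hg (hr x))) h
  · intro y hy hyx
    change (c y • wordProd T (r y)).coeff _ = 0
    rw [coeff_smul, Finsupp.smul_apply]
    by_cases hcy : c y = 0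
    · rw [hcy, zero_smul]
    · by_contra h'
      rcases exists_of_coeff_wordProd_ne_zero hT _ _ (right_ne_zero_of_smul h') with e | ⟨l, hl, e⟩
      · exact hyx (hinj e.symm)
      · have h1 := hr x l e
        have h2 := hmax y (by simp [hy, hcy])
        lia

end SkewMonoidAlgebra

end

/-! ### Injectivity of the homomorphism and the main theorem. -/

noncomputable section

namespace AffineRootSystem

open AffineRoot ReducedWord RankTwo

variable {V P : Type*} [NormedAddCommGroup V] [InnerProductSpace ℝ V] [FiniteDimensional ℝ V]
  [MetricSpace P] [NormedAddTorsor V P] {R : AffineRootSystem V P}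

/-- The exponents 0, x and 2x satisfy x ≠ 0 and 2x ≠ 0, so the coefficient of e^0 is a. -/
theorem algebraMap_add_mul_e_sub_ne_zero {x : R.rootLattice} (hx : x ≠ 0) (hx' : 2 • x ≠ 0)
    {a : ℂ} (ha : a ≠ 0) (b c : ℂ) :
    algebraMap ℂ R.F a + algebraMap ℂ R.F b * R.e x - algebraMap ℂ R.F c * R.e x ^ 2 ≠ 0 := by
  intro h
  have hs (r : ℂ) (y : R.rootLattice) : algebraMap ℂ R.F r * R.e y =
      algebraMap R.GroupAlg R.F (AddMonoidAlgebra.single y r) := by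
    rw [e, ← Algebra.smul_def, ← algebraMap.coe_smul, AddMonoidAlgebra.smul_single, smul_eq_mul,
      mul_one]
  rw [← mul_one (algebraMap ℂ R.F a), ← R.e_zero, ← e_nsmul, hs, hs, hs, ← map_add, ← map_sub] at h
  have h' := (IsFractionRing.to_map_eq_zero_iff (K := R.F)).1 h
  have := congrArg (fun p : R.GroupAlg => p.coeff 0) h'
  simp [hx, hx', ha] at this

namespace OrderedBasis

variable {n : ℕ} (Δ : R.OrderedBasis n)

theorem dFunction_expRoot_inv_ne_zero (i : Fin (n + 1)) {κ : ℂ} (hκ : κ ≠ 0) (v : ℂ) :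
    dFunction κ v (Δ.expRoot i)⁻¹ ≠ 0 := by
  have h2 := Δ.one_sub_expRoot_sq_ne_zero i
  have h2' : 1 - (Δ.expRoot i)⁻¹ ^ 2 ≠ 0 := by
    rw [← Δ.smul_expRoot_self i, ← smul_pow', ← smul_one (Δ.simpleReflection i), ← smul_sub]
    exact (smul_ne_zero_iff_ne _).2 h2
  rw [dFunction, ← map_inv₀, ← map_inv₀, ← map_sub]
  refine div_ne_zero ?_ h2'
  rw [expRoot, ← e_neg]
  rw [expRoot, ← e_neg, ← e_nsmul] at h2'
  have h0 : 2 • -R.rootInLattice (Δ.simpleRoot i) ≠ 0 := by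
    intro h
    rw [h, e_zero, sub_self] at h2'
    exact h2' rfl
  exact algebraMap_add_mul_e_sub_ne_zero (fun h => h0 (by rw [h, smul_zero])) h0 hκ _ _

/-- This is the form required by the triangularity argument: the coefficient at s_i is the function
shown to be nonzero in `dFunction_expRoot_inv_ne_zero`. -/
theorem demazureLusztig_eq_single_add_single (k : R.roots → ℂˣ) (i : Fin (n + 1)) :
    Δ.demazureLusztig k i =
      SkewMonoidAlgebra.single 1 (dFunction (k (Δ.simpleRoot i) : ℂ)
        (R.kTwo k (Δ.simpleRoot i) : ℂ) (Δ.expRoot i) - algebraMap ℂ R.F (k (Δ.simpleRoot i) : ℂ)⁻¹)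
      + SkewMonoidAlgebra.single (Δ.simpleReflection i) (dFunction (k (Δ.simpleRoot i) : ℂ)
        (R.kTwo k (Δ.simpleRoot i) : ℂ) (Δ.expRoot i)⁻¹) := by
  rw [demazureLusztig_eq, lusztig_eq_add R.ofWHom_mul_ofFHom (Δ.smul_expRoot_self i)]
  congr 1
  change SkewMonoidAlgebra.single 1 _ * SkewMonoidAlgebra.single _ 1 = _
  rw [SkewMonoidAlgebra.single_mul_single, one_mul, one_smul, mul_one]

/-- The homomorphism `T_i ↦ k_i s_i + c_i (1 - s_i)` from the affine Hecke algebra to `W ⋉ F`. -/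
def heckeHom (k : R.roots → ℂˣ) (hk : ∀ (w : R.weylGroup) (a : R.roots), k (R.rootAct w a) = k a) :
    Δ.AffineHecke k →ₐ[ℂ] R.WF :=
  CartanHecke.heckeLift (Δ.demazureLusztig k) (Δ.demazureLusztig_quadratic k)
    fun _ _ hij => Δ.demazureLusztig_braid hij hk

theorem heckeHom_T (k : R.roots → ℂˣ)
    (hk : ∀ (w : R.weylGroup) (a : R.roots), k (R.rootAct w a) = k a) (i : Fin (n + 1)) :
    Δ.heckeHom k hk (Δ.T k i) = Δ.demazureLusztig k i :=
  CartanHecke.heckeLift_heckeT _ _ _ i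

theorem heckeHom_injective (k : R.roots → ℂˣ)
    (hk : ∀ (w : R.weylGroup) (a : R.roots), k (R.rootAct w a) = k a) :
    Function.Injective (Δ.heckeHom k hk) := by
  let s := Δ.simpleReflection
  -- One reduced word is fixed for each product of simple reflections. It need not be known that
  -- these products exhaust the affine Weyl group.
  let κ := {w : R.weylGroup // ∃ l, IsReduced s l ∧ wordProd s l = w}
  let r : κ → List (Fin (n + 1)) := fun w => w.2.choose
  have hr (w : κ) : IsReduced s (r w) := w.2.choose_spec.1
  have hrw (w : κ) : wordProd s (r w) = w.1 := w.2.choose_spec.2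
  have hT := Δ.heckeHom_T k hk
  have hli : LinearIndependent ℂ fun w => Δ.heckeHom k hk (wordProd (Δ.T k) (r w)) := by
    have hw (l : List (Fin (n + 1))) : Δ.heckeHom k hk (wordProd (Δ.T k) l) =
        wordProd (Δ.demazureLusztig k) l := by
      have := CartanHecke.map_wordProd (Δ.heckeHom k hk : _ →* R.WF) (Δ.T k) l
      refine this.trans (congrArg (fun t => wordProd t l) (funext hT))
    simp only [hw]
    refine SkewMonoidAlgebra.linearIndependent_wordProd (s := s)
      (Δ.demazureLusztig_eq_single_add_single k)
      (fun i => Δ.dFunction_expRoot_inv_ne_zero i (Units.ne_zero _) _) hr fun w w' h => ?_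
    simp only [hrw] at h
    exact Subtype.ext h
  have hspan : Submodule.span ℂ (Set.range fun w => wordProd (Δ.T k) (r w)) = ⊤ := by
    rw [← CartanHecke.span_wordProd_heckeT Δ.descentSystem (fun i j hij m => Δ.not_isDescent_altList hij m)
      Δ.braidExponent_comm (fun i j hij m => Δ.simpleReflection_braid hij m)
      Δ.braidExponent_ne_zero]
    congr 1
    ext x
    constructor
    · rintro ⟨w, rfl⟩
      exact ⟨_, hr w, rfl⟩
    · rintro ⟨l, hl, rfl⟩
      refine ⟨⟨_, l, hl, rfl⟩, ?_⟩
      exact Δ.descentSystem.matsumoto (fun i j hij m => Δ.not_isDescent_altList hij m)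
        Δ.braidExponent_comm (fun i j hij m => Δ.simpleReflection_braid hij m)
        (fun i j hij m => CartanHecke.heckeT_braid hij m)
        Δ.braidExponent_ne_zero (hr _) hl (hrw _)
  rw [← AlgHom.coe_toLinearMap, ← LinearMap.ker_eq_bot, LinearMap.ker_eq_bot']
  intro x hx
  obtain ⟨c, rfl⟩ := Finsupp.mem_span_range_iff_exists_finsupp.1 (hspan ▸ Submodule.mem_top (x := x))
  rw [map_finsuppSum] at hx
  simp only [map_smul] at hx
  have := linearIndependent_iff.1 hli c hx
  rw [this, Finsupp.sum_zero_index]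

end OrderedBasis

end AffineRootSystem

end

theorem mainTheorem9 {V P : Type*} [NormedAddCommGroup V] [InnerProductSpace ℝ V]
    [FiniteDimensional ℝ V] [MetricSpace P] [NormedAddTorsor V P]
    (R : AffineRootSystem V P) (hR : R.IsIrreducible)
    (n : ℕ) (Δ : R.OrderedBasis n)
    (k : R.roots → ℂˣ) (hk : ∀ (w : R.weylGroup) (a : R.roots), k (R.rootAct w a) = k a) :
    ∃! β : Δ.AffineHecke k →ₐ[ℂ] R.WF,
      Function.Injective β ∧
      ∀ i : Fin (n + 1),
        β (Δ.T k i) =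
          (k (Δ.simpleRoot i) : ℂ) • R.ofW (R.s (Δ.simpleRoot i)) +
            R.ofF (R.cFunction k (Δ.simpleRoot i)) * (1 - R.ofW (R.s (Δ.simpleRoot i))) :=
  ⟨Δ.heckeHom k hk, ⟨Δ.heckeHom_injective k hk, Δ.heckeHom_T k hk⟩, fun _ h =>
    CartanHecke.hecke_hom_ext fun i => (h.2 i).trans (Δ.heckeHom_T k hk i).symm⟩
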